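/- Let $k$ be a field and let $A$ be a connected cochain DG $k$-algebra, i.e. a $\mathbb{Z}$-graded $k$-algebra with $A^i=0$ for $i<0$ and $A^0=k$, with a $k$-linear differential $\partial_A$ of degree $+1$ satisfying $\partial_A^2=0$ and $\partial_A(ab)=\partial_A(a)b+(-1)^{|a|}a\,\partial_A(b)$. Assume that the cohomology algebra $H(A)$ is left Noetherian. Let $\mathrm{D}(A)$ be the derived category of left DG $A$-modules (quasi-isomorphisms inverted), and let $M$ be a left DG $A$-module whose cohomology $H(M)$ is a finitely generated left $H(A)$-module. Then $M$ is compact in $\mathrm{D}(A)$, i.e. $\mathrm{Hom}_{\mathrm{D}(A)}(M,-)$ preserves all coproducts, if and only if $\mathrm{cl}_A M<+\infty$. Here a DG module is DG free if it has an $A$-basis of homogeneous cocycles. A semi-free filtration of a DG module $F$ is a sequence of DG submodules $0=F(-1)\subseteq F(0)\subseteq F(1)\subseteq\cdots$ with $F=\bigcup_n F(n)$ and every $F(n)/F(n-1)$ DG free; $F$ is semi-free if it has one. The filtration is strictly increasing if $F(i-1)\neq F(i)$ whenever $F(i-1)\neq F$, and it has length $n\in\mathbb{N}$ if $F(n)=F$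 and $F(n-1)\neq F$. The DG free class of $F$ is the least length of a strictly increasing semi-free filtration of $F$ ($+\infty$ if there is none of finite length), and the cone length $\mathrm{cl}_A M\in\mathbb{N}\cup\{+\infty\}$ is the infimum of the DG free classes of all semi-free DG modules $F$ that admit a quasi-isomorphism $F\to M$. -/

import Mathlib

open CategoryTheory Limits Opposite

universe v₁ u₁ v u
set_option linter.unusedSectionVars false

noncomputable section

namespace LocalizationAdd
variable {C : Type u₁} [Category.{v₁} C] [Preadditive C] [HasBinaryProducts C]
  (W : MorphismProperty C)

instance hasBinaryBiproducts : HasBinaryBiproducts C := HasBinaryBiproducts.of_hasBinaryProducts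

section
variable [W.ContainsIdentities] [W.IsStableUnderProductsOfShape WalkingPair]

def fanIsLimit (Y Z : C) :
    IsLimit (BinaryFan.mk (W.Q.map (biprod.fst : Y ⊞ Z ⟶ Y)) (W.Q.map biprod.snd)) :=
  haveI := Localization.preservesProductsOfShape W.Q W WalkingPair
  mapIsLimitOfPreservesOfIsLimit W.Q _ _ (BinaryBiproduct.isLimit Y Z)

variable {W}
def pairing {X : W.Localization} {Y Z : C} (f : X ⟶ W.Q.obj Y) (g : X ⟶ W.Q.obj Z) :
    X ⟶ W.Q.obj (Y ⊞ Z) :=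
  (BinaryFan.IsLimit.lift' (fanIsLimit W Y Z) f g).1

lemma pairing_fst {X : W.Localization} {Y Z : C} (f : X ⟶ W.Q.obj Y) (g : X ⟶ W.Q.obj Z) :
    pairing f g ≫ W.Q.map biprod.fst = f :=
  (BinaryFan.IsLimit.lift' (fanIsLimit W Y Z) f g).2.1

lemma pairing_snd {X : W.Localization} {Y Z : C} (f : X ⟶ W.Q.obj Y) (g : X ⟶ W.Q.obj Z) :
    pairing f g ≫ W.Q.map biprod.snd = g :=
  (BinaryFan.IsLimit.lift' (fanIsLimit W Y Z) f g).2.2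

lemma pairing_eq {X : W.Localization} {Y Z : C} (f : X ⟶ W.Q.obj Y) (g : X ⟶ W.Q.obj Z)
    (h : X ⟶ W.Q.obj (Y ⊞ Z)) (h₁ : h ≫ W.Q.map biprod.fst = f) (h₂ : h ≫ W.Q.map biprod.snd = g) :
    h = pairing f g :=
  BinaryFan.IsLimit.hom_ext (fanIsLimit W Y Z) (h₁.trans (pairing_fst f g).symm)
    (h₂.trans (pairing_snd f g).symm)

/-- The sum of two morphisms into `Q Y`: pair them, then apply the image under `Q` of the
sum `Y ⊞ Y ⟶ Y` of the two projections. -/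
def add {X : W.Localization} {Y : C} (f g : X ⟶ W.Q.obj Y) : X ⟶ W.Q.obj Y :=
  pairing f g ≫ W.Q.map (biprod.fst + biprod.snd)

lemma comp_map_add {X : W.Localization} {Y Z : C} (u : X ⟶ W.Q.obj Y) (φ ψ : Y ⟶ Z) :
    add (u ≫ W.Q.map φ) (u ≫ W.Q.map ψ) = u ≫ W.Q.map (φ + ψ) := by
  have h : u ≫ W.Q.map (biprod.lift φ ψ) = pairing (u ≫ W.Q.map φ) (u ≫ W.Q.map ψ) := by
    apply pairing_eq <;> simp [← Functor.map_comp]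
  rw [add, ← h, Category.assoc, ← Functor.map_comp]
  simp

lemma comp_add' {X' X : W.Localization} {Y : C} (u : X' ⟶ X) (f g : X ⟶ W.Q.obj Y) :
    u ≫ add f g = add (u ≫ f) (u ≫ g) := by
  have h : u ≫ pairing f g = pairing (u ≫ f) (u ≫ g) := by
    apply pairing_eq <;> simp [pairing_fst, pairing_snd]
  rw [add, add, ← h, Category.assoc]

lemma add_comp_map {X : W.Localization} {Y Z : C} (f g : X ⟶ W.Q.obj Y) (φ : Y ⟶ Z) :
    add f g ≫ W.Q.map φ = add (f ≫ W.Q.map φ) (g ≫ W.Q.map φ) := by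
  conv_rhs => rw [← pairing_fst f g]
  conv_rhs => enter [2]; rw [← pairing_snd f g]
  rw [Category.assoc, Category.assoc, ← Functor.map_comp, ← Functor.map_comp, comp_map_add, add,
    Category.assoc, ← Functor.map_comp, Preadditive.add_comp]

variable (W) in
/-- The object of `C` underlying an object of the localization: `Q (pt Y) = Y`. -/
def pt (Y : W.Localization) : C := (Localization.Construction.objEquiv W).symm Y

/-- A morphism to `Y`, seen as a morphism to `Q (pt Y) = Y`. -/
def toQ {X Y : W.Localization} (f : X ⟶ Y) : X ⟶ W.Q.obj (pt W Y) := f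

/-- A morphism to `Q (pt Y) = Y`, seen as a morphism to `Y`. -/
def ofQ {X Y : W.Localization} (f : X ⟶ W.Q.obj (pt W Y)) : X ⟶ Y := f

/-- The sum of two morphisms of the localization. -/
def addHom {X Y : W.Localization} (f g : X ⟶ Y) : X ⟶ Y := ofQ (add (toQ f) (toQ g))

lemma addHom_eq_add {X : W.Localization} {Y : C} (f g : X ⟶ W.Q.obj Y) :
    addHom f g = add f g := rfl

lemma comp_addHom {X' X Y : W.Localization} (u : X' ⟶ X) (f g : X ⟶ Y) :
    u ≫ addHom f g = addHom (u ≫ f) (u ≫ g) :=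
  comp_add' u (toQ f) (toQ g)

lemma addHom_comp {X Y Z : W.Localization} (f g : X ⟶ Y) (h : Y ⟶ Z) :
    addHom f g ≫ h = addHom (f ≫ h) (g ≫ h) := by
  let P : MorphismProperty W.Localization := fun Y Z h =>
    ∀ (X : W.Localization) (f g : X ⟶ Y), addHom f g ≫ h = addHom (f ≫ h) (g ≫ h)
  have : P.IsStableUnderComposition := ⟨fun a b ha hb X f g => by
    rw [← Category.assoc, ha, hb, Category.assoc, Category.assoc]⟩
  have hP : P = ⊤ := Localization.Construction.morphismProperty_eq_top' P
    (fun _ _ φ _ f g => add_comp_map f g φ)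
    (fun Y Z e he X f g => by
      rw [Iso.comp_inv_eq, he]
      simp)
  have : P h := by rw [hP]; trivial
  exact this X f g

lemma exists_eq_map (X : W.Localization) : ∃ Y : C, W.Q.obj Y = X :=
  ⟨pt W X, (Localization.Construction.objEquiv W).apply_symm_apply X⟩

lemma addHom_map {X Y : C} (φ ψ : X ⟶ Y) :
    addHom (W.Q.map φ) (W.Q.map ψ) = W.Q.map (φ + ψ) := by
  simpa [addHom_eq_add] using comp_map_add (𝟙 (W.Q.obj X)) φ ψ

/-- The zero morphism of the localization. -/
def zeroHom (X Y : W.Localization) : X ⟶ Y := ofQ (W.Q.map (0 : pt W X ⟶ pt W Y))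

lemma zeroHom_eq (X Y : C) : zeroHom (W.Q.obj X) (W.Q.obj Y) = W.Q.map 0 := rfl

lemma comp_zeroHom {X Y : W.Localization} (h : X ⟶ Y) (Z : W.Localization) :
    h ≫ zeroHom Y Z = zeroHom X Z := by
  let P : MorphismProperty W.Localization := fun X Y h => h ≫ zeroHom Y Z = zeroHom X Z
  have : P.IsStableUnderComposition := ⟨fun a b ha hb => by
    change (a ≫ b) ≫ _ = _
    rw [Category.assoc, show b ≫ _ = _ from hb, show a ≫ _ = _ from ha]⟩
  have hP : P = ⊤ := Localization.Construction.morphismProperty_eq_top' P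
    (fun X Y φ => by
      obtain ⟨Z, rfl⟩ := exists_eq_map Z
      change W.Q.map φ ≫ zeroHom _ _ = zeroHom _ _
      rw [zeroHom_eq, zeroHom_eq, ← Functor.map_comp, comp_zero])
    (fun Y Z e he => (Iso.inv_comp_eq e).2 he.symm)
  have : P h := by rw [hP]; trivial
  exact this

/-- The opposite of a morphism of the localization. -/
def negHom {X Y : W.Localization} (f : X ⟶ Y) : X ⟶ Y := ofQ (toQ f ≫ W.Q.map (-𝟙 (pt W Y)))

lemma negHom_eq {X : W.Localization} {Y : C} (f : X ⟶ W.Q.obj Y) :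
    negHom f = f ≫ W.Q.map (-𝟙 Y) := rfl

/-- Two morphisms with the same target factor through a common pair of morphisms of `C`. -/
lemma exists_pair {X : W.Localization} {Y Z : C} (f : X ⟶ W.Q.obj Y) (g : X ⟶ W.Q.obj Z) :
    ∃ u : X ⟶ W.Q.obj (Y ⊞ Z), f = u ≫ W.Q.map biprod.fst ∧ g = u ≫ W.Q.map biprod.snd :=
  ⟨pairing f g, (pairing_fst f g).symm, (pairing_snd f g).symm⟩

lemma addHom_comm {X Y : W.Localization} (f g : X ⟶ Y) : addHom f g = addHom g f := by
  obtain ⟨Y, rfl⟩ := exists_eq_map Y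
  obtain ⟨u, rfl, rfl⟩ := exists_pair f g
  rw [← comp_addHom, ← comp_addHom, addHom_map, addHom_map, add_comm]

lemma addHom_assoc {X Y : W.Localization} (f g h : X ⟶ Y) :
    addHom (addHom f g) h = addHom f (addHom g h) := by
  obtain ⟨Y, rfl⟩ := exists_eq_map Y
  obtain ⟨u, rfl, rfl⟩ := exists_pair f g
  obtain ⟨v, rfl, rfl⟩ := exists_pair u h
  simp only [Category.assoc, ← Functor.map_comp, ← comp_addHom, addHom_map, add_assoc]

lemma zeroHom_addHom {X Y : W.Localization} (f : X ⟶ Y) : addHom (zeroHom X Y) f = f := by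
  obtain ⟨Y, rfl⟩ := exists_eq_map Y
  conv_lhs => rw [← Category.comp_id f, ← comp_zeroHom f, ← comp_addHom, zeroHom_eq,
    ← W.Q.map_id, addHom_map, zero_add, W.Q.map_id, Category.comp_id]

lemma negHom_addHom {X Y : W.Localization} (f : X ⟶ Y) :
    addHom (negHom f) f = zeroHom X Y := by
  obtain ⟨Y, rfl⟩ := exists_eq_map Y
  rw [negHom_eq]
  conv_lhs => enter [2]; rw [← Category.comp_id f, ← W.Q.map_id]
  rw [← comp_addHom, addHom_map, neg_add_cancel, ← zeroHom_eq, comp_zeroHom]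

variable (W) in
/-- The localization of a category with biproducts at a class of morphisms stable under binary
products is preadditive. -/
@[reducible]
def preadditive : Preadditive W.Localization where
  homGroup X Y :=
    letI : Zero (X ⟶ Y) := ⟨zeroHom X Y⟩
    letI : Add (X ⟶ Y) := ⟨addHom⟩
    letI : Neg (X ⟶ Y) := ⟨negHom⟩
    { nsmul := nsmulRec
      zsmul := zsmulRec
      add_assoc := addHom_assoc
      zero_add := zeroHom_addHom
      add_zero := fun f => (addHom_comm _ _).trans (zeroHom_addHom f)
      add_comm := addHom_comm
      neg_add_cancel := negHom_addHom }
  add_comp _ _ _ f g h := addHom_comp f g h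
  comp_add _ _ _ f g h := comp_addHom f g h

/-- With this addition, the localization functor is additive. -/
lemma Q_additive :
    letI := preadditive W
    W.Q.Additive :=
  letI := preadditive W
  ⟨fun {_ _ f g} => (addHom_map f g).symm⟩

end
end LocalizationAdd

open DirectSum in
/-- The grading of a product of two graded abelian groups. -/
@[reducible]
def prodDecomposition {M N : Type*} [AddCommGroup M] [AddCommGroup N] (ℳ : ℤ → AddSubgroup M)
    (𝒩 : ℤ → AddSubgroup N) [Decomposition ℳ] [Decomposition 𝒩] :
    Decomposition fun i => (ℳ i).prod (𝒩 i) :=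
  let f : ∀ i, ℳ i →+ (ℳ i).prod (𝒩 i) := fun i =>
    { toFun := fun x => ⟨(x, 0), x.2, zero_mem _⟩
      map_zero' := rfl
      map_add' := fun _ _ => Subtype.ext (Prod.ext rfl (add_zero _).symm) }
  let g : ∀ i, 𝒩 i →+ (ℳ i).prod (𝒩 i) := fun i =>
    { toFun := fun x => ⟨(0, x), zero_mem _, x.2⟩
      map_zero' := rfl
      map_add' := fun _ _ => Subtype.ext (Prod.ext (add_zero _).symm rfl) }
  Decomposition.ofAddHom _
    (AddMonoidHom.coprod ((DirectSum.map f).comp (decomposeAddEquiv ℳ).toAddMonoidHom)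
      ((DirectSum.map g).comp (decomposeAddEquiv 𝒩).toAddMonoidHom))
    (by
      have hf : ∀ m : M, DirectSum.coeAddMonoidHom (fun i => (ℳ i).prod (𝒩 i))
          (DirectSum.map f (decompose ℳ m)) = (m, 0) := fun m => by
        induction m using Decomposition.inductionOn ℳ with
        | zero => rw [decompose_zero, map_zero, map_zero]; rfl
        | homogeneous m => simp [f]
        | add m m' h h' => rw [decompose_add, map_add, map_add, h, h']; simp
      have hg : ∀ n : N, DirectSum.coeAddMonoidHom (fun i => (ℳ i).prod (𝒩 i))
          (DirectSum.map g (decompose 𝒩 n)) = (0, n) := fun n => by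
        induction n using Decomposition.inductionOn 𝒩 with
        | zero => rw [decompose_zero, map_zero, map_zero]; rfl
        | homogeneous n => simp [g]
        | add n n' h h' => rw [decompose_add, map_add, map_add, h, h']; simp
      refine AddMonoidHom.ext fun x => ?_
      refine (map_add _ _ _).trans ((congrArg₂ (· + ·) (hf x.1) (hg x.2)).trans ?_)
      simp)
    (by
      ext i ⟨⟨m, n⟩, hm, hn⟩ : 2
      have hm' : decompose ℳ m = DirectSum.of (fun i => ℳ i) i ⟨m, hm⟩ := decompose_of_mem ℳ hm
      have hn' : decompose 𝒩 n = DirectSum.of (fun i => 𝒩 i) i ⟨n, hn⟩ := decompose_of_mem 𝒩 hn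
      simp only [AddMonoidHom.comp_apply, coeAddMonoidHom_of, AddMonoidHom.coprod_apply,
        AddMonoidHom.id_apply]
      change DirectSum.map f (decompose ℳ m) + DirectSum.map g (decompose 𝒩 n) = _
      rw [hm', hn', DirectSum.map_of, DirectSum.map_of, ← map_add]
      congr 1
      exact Subtype.ext (Prod.ext (add_zero _) (zero_add _)))

/-- A (cochain) differential graded algebra over a field `k`: a `ℤ`-graded `k`-algebra
`A = ⨁ Aⁱ` with a `k`-linear map `∂` of degree `+1` such that `∂ ∘ ∂ = 0` and
`∂ (a b) = (∂ a) b + (-1)^{|a|} a (∂ b)`. -/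
structure DGAlgebra (k : Type v) [Field k] where
  carrier : Type u
  [ring : Ring carrier]
  [algebra : Algebra k carrier]
  gr : ℤ → Submodule k carrier
  [gradedAlgebra : GradedAlgebra gr]
  d : carrier →ₗ[k] carrier
  d_mem : ∀ (i : ℤ) (a : carrier), a ∈ gr i → d a ∈ gr (i + 1)
  d_d : ∀ a : carrier, d (d a) = 0
  leibniz : ∀ (i : ℤ) (a b : carrier), a ∈ gr i →
    d (a * b) = d a * b + i.negOnePow • (a * d b)

attribute [instance] DGAlgebra.ring DGAlgebra.algebra DGAlgebra.gradedAlgebra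

namespace DGAlgebra
variable {k : Type v} [Field k] (A : DGAlgebra.{v, u} k)

/-- `A` is connected: `Aⁱ = 0` for `i < 0`, and `A⁰ = k`. -/
structure IsConnected : Prop where
  gr_neg : ∀ i : ℤ, i < 0 → A.gr i = ⊥
  gr_zero : ∀ a : A.carrier, a ∈ A.gr 0 ↔ ∃ c : k, algebraMap k A.carrier c = a
  injective : Function.Injective (algebraMap k A.carrier)

lemma d_mul_of_d_eq_zero (a b : A.carrier) (hb : A.d b = 0) : A.d (a * b) = A.d a * b := by
  induction a using DirectSum.Decomposition.inductionOn A.gr with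
  | zero => simp
  | homogeneous m => rw [A.leibniz _ _ _ m.2, hb]; simp
  | add m m' hm hm' => rw [add_mul, map_add, hm, hm', map_add, add_mul]

lemma d_one : A.d 1 = 0 := by
  have h := A.leibniz 0 1 1 SetLike.GradedOne.one_mem
  simpa using h

/-- The graded `k`-algebra of cocycles. -/
def cocycles : Subring A.carrier where
  carrier := {a | A.d a = 0}
  mul_mem' {a b} ha hb := by
    change A.d (a * b) = 0
    rw [A.d_mul_of_d_eq_zero a b hb, show A.d a = 0 from ha, zero_mul]
  one_mem' := A.d_one
  add_mem' {a b} ha hb := by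
    change A.d (a + b) = 0
    rw [map_add, show A.d a = 0 from ha, show A.d b = 0 from hb, add_zero]
  zero_mem' := map_zero A.d
  neg_mem' {a} ha := by
    change A.d (-a) = 0
    rw [map_neg, show A.d a = 0 from ha, neg_zero]

lemma mem_cocycles {a : A.carrier} : a ∈ A.cocycles ↔ A.d a = 0 := Iff.rfl

open DirectSum in
/-- The homogeneous components of a cocycle are cocycles. -/
lemma d_component (a : A.carrier) (ha : A.d a = 0) (i : ℤ) : A.d (decompose A.gr a i) = 0 := by
  have key : ∀ b : A.carrier,
      A.d (decompose A.gr b i) = (decompose A.gr (A.d b) (i + 1) : A.carrier) := by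
    intro b
    induction b using DirectSum.Decomposition.inductionOn A.gr with
    | zero => simp
    | @homogeneous j m =>
      by_cases h : j = i
      · subst h
        rw [decompose_of_mem_same _ m.2, decompose_of_mem_same _ (A.d_mem _ _ m.2)]
      · rw [decompose_of_mem_ne _ m.2 h, decompose_of_mem_ne _ (A.d_mem _ _ m.2) (by omega),
          map_zero]
    | add m m' hm hm' => simp [decompose_add, hm, hm']
  rw [key, ha]; simp

/-- A cocycle times a boundary is a boundary, for any left action satisfying the Leibniz rule. -/
lemma exists_d_of_cocycle {M : Type*} [AddCommGroup M] [Module A.carrier M] (d : M →+ M)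
    (leibniz : ∀ (i : ℤ) (a : A.carrier) (m : M), a ∈ A.gr i →
      d (a • m) = A.d a • m + i.negOnePow • (a • d m))
    (z : A.carrier) (hz : A.d z = 0) (m : M) : ∃ n : M, d n = z • d m := by
  classical
  rw [← DirectSum.sum_support_decompose A.gr z, Finset.sum_smul]
  have key : ∀ i : ℤ, ∃ n : M, d n = (DirectSum.decompose A.gr z i : A.carrier) • d m := by
    intro i
    refine ⟨i.negOnePow • ((DirectSum.decompose A.gr z i : A.carrier) • m), ?_⟩
    have h := leibniz i _ m (DirectSum.decompose A.gr z i).2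
    rw [A.d_component z hz, zero_smul, zero_add] at h
    rw [Units.smul_def, map_zsmul, h, ← Units.smul_def, smul_smul, Int.units_mul_self, one_smul]
  choose n hn using key
  exact ⟨∑ i ∈ (DirectSum.decompose A.gr z).support, n i, by rw [map_sum]; simp only [hn]⟩

/-- The two-sided ideal of boundaries in the algebra of cocycles. -/
def boundaries : Ideal A.cocycles where
  carrier := {z | ∃ y : A.carrier, A.d y = z}
  add_mem' := by
    rintro a b ⟨x, hx⟩ ⟨y, hy⟩
    exact ⟨x + y, by rw [map_add, hx, hy]; rfl⟩
  zero_mem' := ⟨0, map_zero _⟩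
  smul_mem' := by
    rintro z w ⟨y, hy⟩
    obtain ⟨n, hn⟩ := A.exists_d_of_cocycle A.d.toAddMonoidHom A.leibniz z z.2 y
    exact ⟨n, hn.trans (congrArg (z.1 * ·) hy)⟩

instance : A.boundaries.IsTwoSided :=
  ⟨by
    rintro z w ⟨y, hy⟩
    exact ⟨y * w, by rw [A.d_mul_of_d_eq_zero _ _ w.2, hy]; rfl⟩⟩

/-- The cohomology algebra `H(A) = ker ∂ / im ∂`. -/
abbrev Cohomology : Type u := A.cocycles ⧸ A.boundaries

end DGAlgebra

/-- A left DG module over `A`: a graded left `A`-module with a map `∂` of degree `+1` such that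
`∂ ∘ ∂ = 0` and `∂ (a m) = (∂ a) m + (-1)^{|a|} a (∂ m)`. The `k`-vector space structure is the one
obtained from `k → A`; the homogeneous parts and `∂` are then automatically `k`-linear, see
`DGModule.algebraMap_smul_mem` and `DGModule.d_algebraMap_smul`. -/
structure DGModule {k : Type v} [Field k] (A : DGAlgebra.{v, u} k) where
  carrier : Type u
  [addCommGroup : AddCommGroup carrier]
  [module : Module A.carrier carrier]
  gr : ℤ → AddSubgroup carrier
  [decomposition : DirectSum.Decomposition gr]
  smul_mem : ∀ (i j : ℤ) (a : A.carrier) (m : carrier), a ∈ A.gr i → m ∈ gr j → a • m ∈ gr (i + j)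
  d : carrier →+ carrier
  d_mem : ∀ (i : ℤ) (m : carrier), m ∈ gr i → d m ∈ gr (i + 1)
  d_d : ∀ m : carrier, d (d m) = 0
  leibniz : ∀ (i : ℤ) (a : A.carrier) (m : carrier), a ∈ A.gr i →
    d (a • m) = A.d a • m + i.negOnePow • (a • d m)

attribute [instance] DGModule.addCommGroup DGModule.module DGModule.decomposition

namespace DGModule
variable {k : Type v} [Field k] {A : DGAlgebra.{v, u} k}

lemma algebraMap_smul_mem (M : DGModule A) (c : k) (j : ℤ) (m : M.carrier) (hm : m ∈ M.gr j) :
    algebraMap k A.carrier c • m ∈ M.gr j := by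
  simpa using M.smul_mem 0 j _ m (SetLike.algebraMap_mem_graded A.gr c) hm

lemma d_algebraMap_smul (M : DGModule A) (c : k) (m : M.carrier) :
    M.d (algebraMap k A.carrier c • m) = algebraMap k A.carrier c • M.d m := by
  rw [M.leibniz 0 _ m (SetLike.algebraMap_mem_graded A.gr c), Algebra.algebraMap_eq_smul_one,
    map_smul, A.d_one]
  simp

lemma d_smul_of_d_eq_zero (M : DGModule A) (a : A.carrier) (m : M.carrier) (hm : M.d m = 0) :
    M.d (a • m) = A.d a • m := by
  induction a using DirectSum.Decomposition.inductionOn A.gr with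
  | zero => simp
  | homogeneous a => rw [M.leibniz _ _ _ a.2, hm]; simp
  | add a a' ha ha' => rw [add_smul, map_add, ha, ha', map_add, add_smul]

/-- A morphism of DG modules: an `A`-linear map of degree `0` commuting with the differentials. -/
@[ext]
structure Hom (M N : DGModule A) where
  toLin : M.carrier →ₗ[A.carrier] N.carrier
  map_mem : ∀ (i : ℤ) (m : M.carrier), m ∈ M.gr i → toLin m ∈ N.gr i
  map_d : ∀ m : M.carrier, toLin (M.d m) = N.d (toLin m)

/-- The category `C(A)` of left DG modules over `A`. -/
instance : Category (DGModule A) where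
  Hom M N := Hom M N
  id M := ⟨LinearMap.id, fun _ _ h => h, fun _ => rfl⟩
  comp f g := ⟨g.toLin.comp f.toLin, fun i m h => g.map_mem i _ (f.map_mem i m h), fun m => by
    simp [f.map_d, g.map_d]⟩

variable {M N P : DGModule A}

/-- The `A`-linear map underlying a morphism of DG modules. -/
def lin (f : M ⟶ N) : M.carrier →ₗ[A.carrier] N.carrier := Hom.toLin f

lemma lin_mem (f : M ⟶ N) {i : ℤ} {m : M.carrier} (hm : m ∈ M.gr i) : lin f m ∈ N.gr i :=
  Hom.map_mem f i m hm

lemma lin_d (f : M ⟶ N) (m : M.carrier) : lin f (M.d m) = N.d (lin f m) := Hom.map_d f m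

@[ext]
lemma hom_ext {f g : M ⟶ N} (h : lin f = lin g) : f = g := Hom.ext h

@[simp] lemma lin_id : lin (𝟙 M) = LinearMap.id := rfl
@[simp] lemma lin_comp (f : M ⟶ N) (g : N ⟶ P) : lin (f ≫ g) = (lin g).comp (lin f) := rfl

instance : Zero (M ⟶ N) := ⟨(⟨0, fun _ _ _ => zero_mem _, fun _ => by simp⟩ : Hom M N)⟩
instance : Add (M ⟶ N) := ⟨fun f g => (⟨lin f + lin g,
  fun _ _ h => add_mem (lin_mem f h) (lin_mem g h), fun m => by simp [lin_d]⟩ : Hom M N)⟩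
instance : Neg (M ⟶ N) := ⟨fun f => (⟨-lin f,
  fun _ _ h => neg_mem (lin_mem f h), fun m => by simp [lin_d]⟩ : Hom M N)⟩

@[simp] lemma lin_zero : lin (0 : M ⟶ N) = 0 := rfl
@[simp] lemma lin_add (f g : M ⟶ N) : lin (f + g) = lin f + lin g := rfl
@[simp] lemma lin_neg (f : M ⟶ N) : lin (-f) = -lin f := rfl

instance : Preadditive (DGModule A) where
  homGroup M N :=
    { nsmul := nsmulRec
      zsmul := zsmulRec
      add_assoc := fun _ _ _ => hom_ext (by simp [add_assoc])
      zero_add := fun _ => hom_ext (by simp)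
      add_zero := fun _ => hom_ext (by simp)
      add_comm := fun _ _ => hom_ext (by simp [add_comm])
      neg_add_cancel := fun _ => hom_ext (by simp) }
  add_comp _ _ _ _ _ _ := hom_ext (by simp [LinearMap.comp_add])
  comp_add _ _ _ _ _ _ := hom_ext (by simp [LinearMap.add_comp])

/-- The direct sum of two DG modules. -/
def prod (M N : DGModule A) : DGModule A where
  carrier := M.carrier × N.carrier
  gr i := (M.gr i).prod (N.gr i)
  decomposition := prodDecomposition M.gr N.gr
  smul_mem i j a m ha hm := ⟨M.smul_mem i j a _ ha hm.1, N.smul_mem i j a _ ha hm.2⟩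
  d := M.d.prodMap N.d
  d_mem i m hm := ⟨M.d_mem i _ hm.1, N.d_mem i _ hm.2⟩
  d_d m := Prod.ext (M.d_d _) (N.d_d _)
  leibniz i a m ha := Prod.ext (M.leibniz i a _ ha) (N.leibniz i a _ ha)

instance : HasBinaryProducts (DGModule A) := by
  have : ∀ M N : DGModule A, HasLimit (pair M N) := fun M N =>
    HasLimit.mk
      { cone := BinaryFan.mk (P := prod M N)
          (⟨LinearMap.fst _ _ _, fun _ _ h => h.1, fun _ => rfl⟩ : Hom (prod M N) M)
          (⟨LinearMap.snd _ _ _, fun _ _ h => h.2, fun _ => rfl⟩ : Hom (prod M N) N)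
        isLimit := BinaryFan.isLimitMk
          (fun s => (⟨(lin s.fst).prod (lin s.snd),
            fun _ _ h => ⟨lin_mem s.fst h, lin_mem s.snd h⟩,
            fun m => Prod.ext (lin_d s.fst m) (lin_d s.snd m)⟩ : Hom s.pt (prod M N)))
          (fun _ => rfl) (fun _ => rfl)
          (fun s m h₁ h₂ => hom_ext (LinearMap.ext fun x => Prod.ext
            (congrArg (fun t => lin t x) h₁) (congrArg (fun t => lin t x) h₂))) }
  exact hasBinaryProducts_of_hasLimit_pair _

variable (M) in
/-- The cocycles of a DG module, a module over the cocycles of `A`. -/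
def cocycles : Submodule A.cocycles M.carrier where
  carrier := {m | M.d m = 0}
  add_mem' {a b} ha hb := by
    change M.d (a + b) = 0
    rw [map_add, show M.d a = 0 from ha, show M.d b = 0 from hb, add_zero]
  zero_mem' := map_zero M.d
  smul_mem' z m hm := by
    change M.d (z.1 • m) = 0
    rw [M.d_smul_of_d_eq_zero _ _ hm, A.mem_cocycles.1 z.2, zero_smul]

variable (M) in
/-- The boundaries of a DG module, inside its cocycles. -/
def boundaries : Submodule A.cocycles M.cocycles where
  carrier := {z | ∃ y : M.carrier, M.d y = z}
  add_mem' := by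
    rintro a b ⟨x, hx⟩ ⟨y, hy⟩
    exact ⟨x + y, by rw [map_add, hx, hy]; rfl⟩
  zero_mem' := ⟨0, map_zero _⟩
  smul_mem' := by
    rintro z w ⟨y, hy⟩
    obtain ⟨n, hn⟩ := A.exists_d_of_cocycle M.d M.leibniz z z.2 y
    exact ⟨n, hn.trans (congrArg (z.1 • ·) hy)⟩

variable (M) in
/-- The cohomology `H(M) = ker ∂ / im ∂`. -/
abbrev Cohomology : Type u := M.cocycles ⧸ M.boundaries

variable (M) in
lemma isTorsionBySet_cohomology :
    Module.IsTorsionBySet A.cocycles M.Cohomology (A.boundaries : Set A.cocycles) := by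
  intro x
  obtain ⟨m, rfl⟩ := Submodule.Quotient.mk_surjective _ x
  rintro ⟨z, y, hy⟩
  rw [← Submodule.Quotient.mk_smul, Submodule.Quotient.mk_eq_zero]
  exact ⟨y • m.1, by rw [M.d_smul_of_d_eq_zero _ _ m.2, hy]; rfl⟩

/-- `H(M)` is a left module over `H(A)`, by `[z] • [m] = [z m]`. -/
instance : Module A.Cohomology M.Cohomology :=
  M.isTorsionBySet_cohomology.module

/-- The map induced by a morphism of DG modules on cohomology (it is `H(A)`-linear). -/
def cohomologyMap (f : M ⟶ N) : M.Cohomology →ₗ[A.cocycles] N.Cohomology :=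
  Submodule.mapQ _ _
    (((lin f).restrictScalars A.cocycles).restrict fun m hm => by
      change N.d (lin f m) = 0
      rw [← lin_d, show M.d m = 0 from hm, map_zero])
    (by
      rintro ⟨z, hz⟩ ⟨y, hy⟩
      exact ⟨lin f y, by rw [← lin_d, hy]; rfl⟩)

lemma cohomologyMap_comp (f : M ⟶ N) (g : N ⟶ P) (x : M.Cohomology) :
    cohomologyMap (f ≫ g) x = cohomologyMap g (cohomologyMap f x) := by
  obtain ⟨m, rfl⟩ := Submodule.Quotient.mk_surjective _ x
  rfl

lemma cohomologyMap_id (x : M.Cohomology) : cohomologyMap (𝟙 M) x = x := by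
  obtain ⟨m, rfl⟩ := Submodule.Quotient.mk_surjective _ x
  rfl

lemma cohomologyMap_add (f g : M ⟶ N) (x : M.Cohomology) :
    cohomologyMap (f + g) x = cohomologyMap f x + cohomologyMap g x := by
  obtain ⟨m, rfl⟩ := Submodule.Quotient.mk_surjective _ x
  rfl

lemma cohomologyMap_zero (x : M.Cohomology) : cohomologyMap (0 : M ⟶ N) x = 0 := by
  obtain ⟨m, rfl⟩ := Submodule.Quotient.mk_surjective _ x
  rfl

/-- A quasi-isomorphism is a morphism which induces an isomorphism on cohomology. -/
def IsQuasiIso (f : M ⟶ N) : Prop := Function.Bijective (cohomologyMap f)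

variable (A) in
/-- The class of quasi-isomorphisms in `C(A)`. -/
def quasiIso : MorphismProperty (DGModule A) := fun _ _ f => IsQuasiIso f

instance : (quasiIso A).ContainsIdentities :=
  ⟨fun _ => ⟨fun x y h => by simpa only [cohomologyMap_id] using h,
    fun x => ⟨x, cohomologyMap_id x⟩⟩⟩

instance : (quasiIso A).IsMultiplicative where
  comp_mem f g hf hg := by
    have h : (cohomologyMap (f ≫ g) : _ → _) = cohomologyMap g ∘ cohomologyMap f :=
      funext (cohomologyMap_comp f g)
    change Function.Bijective (cohomologyMap (f ≫ g))
    rw [h]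
    exact Function.Bijective.comp hg hf

lemma isQuasiIso_of_isIso (f : M ⟶ N) [IsIso f] : IsQuasiIso f := by
  refine Function.bijective_iff_has_inverse.2 ⟨cohomologyMap (inv f), fun x => ?_, fun x => ?_⟩
  · rw [← cohomologyMap_comp, IsIso.hom_inv_id, cohomologyMap_id]
  · rw [← cohomologyMap_comp, IsIso.inv_hom_id, cohomologyMap_id]

instance : (quasiIso A).RespectsIso :=
  MorphismProperty.respectsIso_of_isStableUnderComposition fun _ _ f hf =>
    haveI : IsIso f := hf
    isQuasiIso_of_isIso f

instance : (quasiIso A).IsStableUnderProductsOfShape WalkingPair := by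
  refine MorphismProperty.IsStableUnderProductsOfShape.mk _ _ fun X Y _ _ f hf => ?_
  have key : ∀ (Z : WalkingPair → DGModule A) [HasProduct Z],
      ∃ (a : Z .left ⟶ ∏ᶜ Z) (b : Z .right ⟶ ∏ᶜ Z),
        Pi.π Z .left ≫ a + Pi.π Z .right ≫ b = 𝟙 _ ∧
        a ≫ Pi.π Z .left = 𝟙 _ ∧ a ≫ Pi.π Z .right = 0 ∧
        b ≫ Pi.π Z .left = 0 ∧ b ≫ Pi.π Z .right = 𝟙 _ := by
    intro Z _
    let a : Z .left ⟶ ∏ᶜ Z := Pi.lift fun j => match j with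
      | .left => 𝟙 _
      | .right => 0
    let b : Z .right ⟶ ∏ᶜ Z := Pi.lift fun j => match j with
      | .left => 0
      | .right => 𝟙 _
    have h₁ : a ≫ Pi.π Z .left = 𝟙 _ := Pi.lift_π _ _
    have h₂ : a ≫ Pi.π Z .right = 0 := Pi.lift_π _ _
    have h₃ : b ≫ Pi.π Z .left = 0 := Pi.lift_π _ _
    have h₄ : b ≫ Pi.π Z .right = 𝟙 _ := Pi.lift_π _ _
    refine ⟨a, b, ?_, h₁, h₂, h₃, h₄⟩
    refine Pi.hom_ext _ _ fun j => ?_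
    match j with
    | .left => simp [h₁, h₃]
    | .right => simp [h₂, h₄]
  have inj : ∀ (Z : WalkingPair → DGModule A) [HasProduct Z] (x y : (∏ᶜ Z).Cohomology),
      (∀ j, cohomologyMap (Pi.π Z j) x = cohomologyMap (Pi.π Z j) y) → x = y := by
    intro Z _ x y h
    obtain ⟨a, b, hab, -⟩ := key Z
    rw [← cohomologyMap_id x, ← cohomologyMap_id y, ← hab]
    simp only [cohomologyMap_add, cohomologyMap_comp, h]
  have comm : ∀ (j : WalkingPair) (x : (∏ᶜ X).Cohomology),
      cohomologyMap (Pi.π Y j) (cohomologyMap (Limits.Pi.map f) x) =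
        cohomologyMap (f j) (cohomologyMap (Pi.π X j) x) := by
    intro j x
    rw [← cohomologyMap_comp, ← cohomologyMap_comp, Pi.map_π]
  refine ⟨fun x y h => inj X x y fun j => (hf j).1 ?_, fun y => ?_⟩
  · rw [← comm, ← comm, h]
  · obtain ⟨a, b, -, h₁, h₂, h₃, h₄⟩ := key X
    obtain ⟨x₁, hx₁⟩ := (hf .left).2 (cohomologyMap (Pi.π Y .left) y)
    obtain ⟨x₂, hx₂⟩ := (hf .right).2 (cohomologyMap (Pi.π Y .right) y)
    refine ⟨cohomologyMap a x₁ + cohomologyMap b x₂, inj Y _ _ fun j => ?_⟩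
    rw [comm, map_add, ← cohomologyMap_comp, ← cohomologyMap_comp]
    match j with
    | .left => rw [h₁, h₃, cohomologyMap_id, cohomologyMap_zero, add_zero, hx₁]
    | .right => rw [h₂, h₄, cohomologyMap_id, cohomologyMap_zero, zero_add, hx₂]

variable (A) in
/-- The derived category `D(A)`: the category of DG modules with the quasi-isomorphisms
formally inverted. -/
abbrev DerivedCat := (quasiIso A).Localization

/-- `D(A)` is preadditive, and `C(A) ⥤ D(A)` is additive, see `LocalizationAdd.Q_additive`. -/
instance : Preadditive (DerivedCat A) := LocalizationAdd.preadditive (quasiIso A)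

/-- A DG module `M` is compact if `Hom_{D(A)}(M, -)`, as a functor to abelian groups, preserves
all (small) coproducts. -/
def IsCompact (M : DGModule A) : Prop :=
  ∀ J : Type u, PreservesColimitsOfShape (Discrete J)
    (preadditiveCoyoneda.obj (op ((quasiIso A).Q.obj M : DerivedCat A)))

/-- `M` is cohomologically finite, i.e. `M` is an object of `D^f(A)`: the left `H(A)`-module `H(M)`
is finitely generated. -/
def IsCohomologicallyFinite (M : DGModule A) : Prop :=
  Module.Finite A.Cohomology M.Cohomology

/-- `N` is a DG submodule: it is graded and stable under the differential. -/
structure IsDGSubmodule (F : DGModule A) (N : Submodule A.carrier F.carrier) : Prop where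
  component_mem : ∀ m ∈ N, ∀ i : ℤ, (DirectSum.decompose F.gr m i : F.carrier) ∈ N
  d_mem : ∀ m ∈ N, F.d m ∈ N

/-- For DG submodules `N ⊆ N'` of `F`, the quotient `N' / N` is a DG free module `⨁ A e_y` with
`∂ e_y = 0`: it has a basis over `A` consisting of the classes of homogeneous elements of `N'`
which are cocycles modulo `N`. (`N' / N` is seen inside `F / N`.) -/
def IsDGFreeQuotient (F : DGModule A) (N N' : Submodule A.carrier F.carrier) : Prop :=
  ∃ (Y : Type u) (deg : Y → ℤ) (e : Y → F.carrier),
    (∀ y, e y ∈ N' ∧ e y ∈ F.gr (deg y) ∧ F.d (e y) ∈ N) ∧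
    LinearIndependent A.carrier (fun y => N.mkQ (e y)) ∧
    Submodule.span A.carrier (Set.range fun y => N.mkQ (e y)) = N'.map N.mkQ

/-- A semi-free filtration `0 = F(-1) ⊆ F(0) ⊆ F(1) ⊆ ⋯` of `F`, where `fil i` is `F(i - 1)`:
an exhaustive increasing sequence of DG submodules with DG free subquotients. -/
structure IsSemifreeFiltration (F : DGModule A) (fil : ℕ → Submodule A.carrier F.carrier) :
    Prop where
  zero : fil 0 = ⊥
  le_succ : ∀ i, fil i ≤ fil (i + 1)
  isDGSubmodule : ∀ i, F.IsDGSubmodule (fil i)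
  free : ∀ i, F.IsDGFreeQuotient (fil i) (fil (i + 1))
  exhaustive : ∀ x : F.carrier, ∃ i, x ∈ fil i

/-- A DG module is semi-free if it has a semi-free filtration. -/
def IsSemifree (F : DGModule A) : Prop := ∃ fil, F.IsSemifreeFiltration fil

/-- `F` has a strictly increasing semi-free filtration (`F(i-1) ≠ F(i)` whenever `F(i-1) ≠ F`) of
length `n`, i.e. with `F(n) = F` and `F(n-1) ≠ F`; recall that `fil i` is `F(i - 1)`. -/
def HasStrictFiltrationOfLength (F : DGModule A) (n : ℕ) : Prop :=
  ∃ fil, F.IsSemifreeFiltration fil ∧ (∀ i, fil i ≠ ⊤ → fil i ≠ fil (i + 1)) ∧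
    fil (n + 1) = ⊤ ∧ fil n ≠ ⊤

/-- The DG free class of a semi-free DG module: the least length of a strictly increasing semi-free
filtration (`⊤ = +∞` if there is none of finite length). -/
def dgFreeClass (F : DGModule A) : ℕ∞ :=
  ⨅ (n : ℕ) (_ : F.HasStrictFiltrationOfLength n), (n : ℕ∞)

/-- The cone length `cl_A M`: the infimum of the DG free classes of all semi-free resolutions
`F ⟶ M` of `M`. -/
def coneLength (M : DGModule A) : ℕ∞ :=
  ⨅ (F : DGModule A) (_ : F.IsSemifree) (f : F ⟶ M) (_ : IsQuasiIso f), F.dgFreeClass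

end DGModule

end

noncomputable section

/-! Call a morphism a ghost if it vanishes on cohomology. Over `M` one builds a tower `G₀ → G₁ → ⋯`
of K-projective modules, starting with the zero map `A → M`. Each stage attaches free generators
that kill the cohomology of the cone `Cₙ` of `Gₙ → M`, so that every transition map `Cₙ → Cₙ₊₁` is a
ghost (`exists_attach`, `exists_tower`). As soon as `M → Cₙ` is zero in the derived category, `M` is
a retract of `Gₙ` there. Both implications come from finding such an `n`.

Suppose `F → M` is a quasi-isomorphism and `F` has a finite semi-free filtration. Each filtration
step is absorbed by one ghost, so `F → M → Cₙ` is null-homotopic for large `n`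
(`nullHomotopic_of_isGhost`). The Noetherian and finiteness hypotheses keep the cohomology of every
cone Noetherian, so finitely many generators suffice at each stage. Then `Gₙ` is K-projective and
finitely generated over `A`, hence compact (`finitelySupported_of_finite`), and so is its retract
`M`.

Suppose `M` is compact. Since the maps `Cₙ → Cₙ₊₁` are ghosts, `id - shift` on `⨁ Cₙ` is a
quasi-isomorphism. Inverting it yields a morphism `M → ⨁ Cₙ` whose components are the maps `M → Cₙ`;
compactness leaves only finitely many of them nonzero (`IsCompact.exists_map_eq_zero`). So `M` is a
retract of some `Gₙ`, which has a semi-free filtration of finite length. The retract is recovered,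
up to quasi-isomorphism, as the mapping telescope of an endomorphism of `Gₙ`. This is the cone of a
self-map of a countable sum of copies of `Gₙ`, so its filtration is only twice as long
(`exists_quasiIso_telescope_of_retract`). Deleting repetitions makes the filtration strict.

The derived category is controlled through K-projective resolutions: out of a K-projective module,
its morphisms are homotopy classes (`IsKProjective.exists_map_eq`,
`IsKProjective.nullHomotopic_of_map_eq_zero`), and direct sums are coproducts
(`isColimitDerivedCofan`). -/

/-- A grading, given by subgroups which generate and by additive projections onto them. -/
@[reducible]
def decompositionOfProj {M : Type*} [AddCommGroup M] (ℳ : ℤ → AddSubgroup M) (p : ℤ → M →+ M)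
    (hsame : ∀ i, ∀ m ∈ ℳ i, p i m = m) (hne : ∀ i j, j ≠ i → ∀ m ∈ ℳ j, p i m = 0)
    (htop : ∀ m, m ∈ ⨆ i, ℳ i) : DirectSum.Decomposition ℳ :=
  DirectSum.IsInternal.chooseDecomposition ℳ (by
    classical
    have key : ∀ (x : DirectSum ℤ fun i => ℳ i) (i : ℤ),
        p i (DirectSum.coeAddMonoidHom ℳ x) = x i := by
      intro x i
      induction x using DirectSum.induction_on with
      | zero => simp
      | of j m =>
        rw [DirectSum.coeAddMonoidHom_of]
        by_cases h : j = i
        · subst h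
          rw [hsame _ _ m.2, DirectSum.of_eq_same]
        · rw [hne _ _ h _ m.2, DirectSum.of_eq_of_ne _ _ _ (Ne.symm h)]
          rfl
      | add x y hx hy => rw [map_add, map_add, hx, hy]; rfl
    refine ⟨fun x y h => DFinsupp.ext fun i => Subtype.ext ?_, fun m => ?_⟩
    · rw [← key, ← key, h]
    · have : (⨆ i, ℳ i) ≤ (DirectSum.coeAddMonoidHom ℳ).range :=
        iSup_le fun i m hm => ⟨DirectSum.of (fun i => ℳ i) i ⟨m, hm⟩, by simp⟩
      exact this (htop m))

namespace DGModule
variable {k : Type v} [Field k] {A : DGAlgebra.{v, u} k} {M N P G : DGModule A}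

/-! ### Homogeneous components and the sign operator -/

section Components

variable (M) in
/-- The homogeneous component of degree `i`. -/
def component (i : ℤ) : M.carrier →+ M.carrier where
  toFun m := (DirectSum.decompose M.gr m i : M.carrier)
  map_zero' := by simp
  map_add' := by simp [DirectSum.decompose_add]

lemma component_mem (i : ℤ) (m : M.carrier) : M.component i m ∈ M.gr i :=
  (DirectSum.decompose M.gr m i).2

lemma component_of_mem {i : ℤ} {m : M.carrier} (hm : m ∈ M.gr i) : M.component i m = m :=
  DirectSum.decompose_of_mem_same _ hm

lemma component_of_mem_ne {i j : ℤ} {m : M.carrier} (hm : m ∈ M.gr j) (h : j ≠ i) :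
    M.component i m = 0 :=
  DirectSum.decompose_of_mem_ne _ hm h

lemma homogeneous_induction {p : M.carrier → Prop} (m : M.carrier) (zero : p 0)
    (hom : ∀ i, ∀ m ∈ M.gr i, p m) (add : ∀ m m', p m → p m' → p (m + m')) : p m :=
  DirectSum.Decomposition.inductionOn M.gr zero (fun {i} m => hom i m m.2) add m

lemma component_d (i : ℤ) (m : M.carrier) : M.component (i + 1) (M.d m) = M.d (M.component i m) := by
  induction m using homogeneous_induction with
  | zero => simp
  | hom j m hm =>
    by_cases h : j = i
    · subst h
      rw [component_of_mem hm, component_of_mem (M.d_mem _ _ hm)]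
    · rw [component_of_mem_ne hm h, component_of_mem_ne (M.d_mem _ _ hm) (by omega), map_zero]
  | add m m' h h' => simp only [map_add, h, h']

lemma component_lin (f : M ⟶ N) (i : ℤ) (m : M.carrier) :
    N.component i (lin f m) = lin f (M.component i m) := by
  induction m using homogeneous_induction with
  | zero => simp
  | hom j m hm =>
    by_cases h : j = i
    · subst h
      rw [component_of_mem hm, component_of_mem (lin_mem f hm)]
    · rw [component_of_mem_ne hm h, component_of_mem_ne (lin_mem f hm) h, map_zero]
  | add m m' h h' => simp only [map_add, h, h']

lemma component_smul {i : ℤ} {a : A.carrier} (ha : a ∈ A.gr i) (j : ℤ) (m : M.carrier) :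
    M.component (i + j) (a • m) = a • M.component j m := by
  induction m using homogeneous_induction with
  | zero => simp
  | hom l m hm =>
    by_cases h : l = j
    · subst h
      rw [component_of_mem hm, component_of_mem (M.smul_mem _ _ _ _ ha hm)]
    · rw [component_of_mem_ne hm h, component_of_mem_ne (M.smul_mem _ _ _ _ ha hm) (by omega),
        smul_zero]
  | add m m' h h' => simp only [map_add, smul_add, h, h']

variable (M) in
lemma sum_component (m : M.carrier) : ∃ s : Finset ℤ, m = ∑ i ∈ s, M.component i m := by
  classical
  exact ⟨_, (DirectSum.sum_support_decompose M.gr m).symm⟩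

variable (M) in
/-- The additive map `m ↦ (-1)^{|m|} m`. -/
def sign : M.carrier →+ M.carrier :=
  (DirectSum.toAddMonoid fun i => (i.negOnePow : ℤ) • (M.gr i).subtype).comp
    (DirectSum.decomposeAddEquiv M.gr).toAddMonoidHom

lemma sign_of_mem {i : ℤ} {m : M.carrier} (hm : m ∈ M.gr i) : M.sign m = i.negOnePow • m := by
  have : DirectSum.decompose M.gr m = DirectSum.of (fun i => M.gr i) i ⟨m, hm⟩ :=
    DirectSum.decompose_of_mem M.gr hm
  change DirectSum.toAddMonoid _ (DirectSum.decompose M.gr m) = _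
  rw [this, DirectSum.toAddMonoid_of]
  rfl

lemma negOnePow_smul_mem {i : ℤ} (j : ℤ) {m : M.carrier} (hm : m ∈ M.gr i) :
    j.negOnePow • m ∈ M.gr i := by
  rw [Units.smul_def]
  exact zsmul_mem hm _

lemma sign_mem {i : ℤ} {m : M.carrier} (hm : m ∈ M.gr i) : M.sign m ∈ M.gr i := by
  rw [sign_of_mem hm]
  exact negOnePow_smul_mem _ hm

@[simp] lemma sign_sign (m : M.carrier) : M.sign (M.sign m) = m := by
  induction m using homogeneous_induction with
  | zero => simp
  | hom i m hm => rw [sign_of_mem (sign_mem hm), sign_of_mem hm, smul_smul, Int.units_mul_self,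
      one_smul]
  | add m m' h h' => rw [map_add, map_add, h, h']

lemma sign_d (m : M.carrier) : M.sign (M.d m) = -M.d (M.sign m) := by
  induction m using homogeneous_induction with
  | zero => simp
  | hom i m hm =>
    rw [sign_of_mem (M.d_mem _ _ hm), sign_of_mem hm, Int.negOnePow_succ, Units.smul_def,
      Units.smul_def, map_zsmul]
    simp
  | add m m' h h' => simp only [map_add, h, h', neg_add]

lemma sign_lin (f : M ⟶ N) (m : M.carrier) : N.sign (lin f m) = lin f (M.sign m) := by
  induction m using homogeneous_induction with
  | zero => simp
  | hom i m hm => rw [sign_of_mem (lin_mem f hm), sign_of_mem hm, Units.smul_def, Units.smul_def,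
      map_zsmul]
  | add m m' h h' => simp only [map_add, h, h']

end Components

/-! ### The algebra as a module over itself -/

section Self

variable (A) in
/-- `A` as a left DG module over itself. -/
abbrev self : DGModule A where
  carrier := A.carrier
  gr i := (A.gr i).toAddSubgroup
  decomposition := decompositionOfProj _
    (fun i => (GradedRing.proj A.gr i))
    (fun i m hm => DirectSum.decompose_of_mem_same _ hm)
    (fun i j h m hm => DirectSum.decompose_of_mem_ne _ hm h)
    (fun m => by
      induction m using DirectSum.Decomposition.inductionOn A.gr with
      | zero => exact zero_mem _
      | homogeneous m => exact AddSubgroup.mem_iSup_of_mem _ m.2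
      | add m m' h h' => exact add_mem h h')
  smul_mem i j a m ha hm := SetLike.GradedMul.mul_mem ha hm
  d := A.d.toAddMonoidHom
  d_mem := A.d_mem
  d_d := A.d_d
  leibniz := A.leibniz

lemma sign_smul (a : A.carrier) (m : M.carrier) :
    M.sign (a • m) = (self A).sign a • M.sign m := by
  induction m using homogeneous_induction with
  | zero => simp
  | add m m' h h' => simp only [smul_add, map_add, h, h']
  | hom i m hm =>
    induction a using (homogeneous_induction (M := self A)) with
    | zero => simp
    | add a b h h' => simp only [add_smul, map_add, h, h']
    | hom j a ha =>
      rw [sign_of_mem (M.smul_mem _ _ _ _ ha hm), sign_of_mem hm, sign_of_mem (M := self A) ha,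
        Int.negOnePow_add]
      simp only [Units.smul_def, mul_smul]
      rw [smul_assoc, smul_comm a]

/-- Carrying the Koszul sign by the additive operator `sign` makes the Leibniz rule valid without
homogeneity, so later identities can be checked on arbitrary elements. -/
lemma d_smul (a : A.carrier) (m : M.carrier) :
    M.d (a • m) = A.d a • m + (self A).sign a • M.d m := by
  induction a using (homogeneous_induction (M := self A)) with
  | zero => simp
  | add a b h h' => simp only [add_smul, map_add, h, h']; abel
  | hom j a ha => rw [M.leibniz _ _ _ ha, sign_of_mem (M := self A) ha, Units.smul_def,
      Units.smul_def, smul_assoc]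

end Self

/-! ### Shifts -/

section Shift

/-- The shift of a DG module (with the same action and the same differential; with the convention
for the grading used here no signs are needed for left modules). -/
abbrev shift (n : ℤ) (M : DGModule A) : DGModule A where
  carrier := M.carrier
  gr i := M.gr (i + n)
  decomposition := decompositionOfProj _ (fun i => M.component (i + n))
    (fun _ _ hm => component_of_mem hm)
    (fun i j h _ hm => component_of_mem_ne hm (by omega))
    (fun m => by
      induction m using homogeneous_induction with
      | zero => exact zero_mem _
      | hom i m hm => exact AddSubgroup.mem_iSup_of_mem (i - n) (by simpa using hm)
      | add m m' h h' => exact add_mem h h')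
  smul_mem i j a m ha hm := by
    have := M.smul_mem _ _ _ _ ha hm
    rwa [← add_assoc] at this
  d := M.d
  d_mem i m hm := by
    have := M.d_mem _ _ hm
    rwa [show i + 1 + n = i + n + 1 by ring]
  d_d := M.d_d
  leibniz := M.leibniz

lemma sign_shift (n : ℤ) (m : M.carrier) : (shift n M).sign m = n.negOnePow • M.sign m := by
  induction m using homogeneous_induction with
  | zero => simp
  | hom i m hm =>
    rw [sign_of_mem hm, sign_of_mem (M := shift n M) (i := i - n) (by simpa using hm), smul_smul]
    congr 1
    rw [Int.negOnePow_sub, mul_comm]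
  | add m m' h h' => rw [map_add, h, h', map_add, smul_add]

@[simp] lemma sign_shift_one (m : M.carrier) : (shift 1 M).sign m = -M.sign m := by
  rw [sign_shift]; simp

/-- The shift of a morphism. -/
def shiftMap (n : ℤ) (f : M ⟶ N) : shift n M ⟶ shift n N :=
  (⟨lin (M := M) (N := N) f, fun _ _ h => lin_mem f h, lin_d f⟩ : Hom (shift n M) (shift n N))

@[simp] lemma lin_shiftMap (n : ℤ) (f : M ⟶ N) : lin (shiftMap n f) = lin (M := M) (N := N) f := rfl

end Shift

/-! ### Extensions of DG modules and mapping cones -/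

section Twist

/-- The extension of `P` by `G` defined by a map `φ : P → G` of degree one: its differential is
`(g, p) ↦ (∂ g + (-1)^{|p|} φ p, ∂ p)`. -/
abbrev twist (φ : P ⟶ shift 1 G) : DGModule A where
  carrier := G.carrier × P.carrier
  gr i := (G.gr i).prod (P.gr i)
  decomposition := prodDecomposition G.gr P.gr
  smul_mem i j a m ha hm := ⟨G.smul_mem i j a _ ha hm.1, P.smul_mem i j a _ ha hm.2⟩
  d :=
    { toFun := fun x => (G.d x.1 + lin φ (P.sign x.2), P.d x.2)
      map_zero' := by simp
      map_add' := fun x y => by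
        refine Prod.ext ?_ ?_
        · simp only [Prod.fst_add, Prod.snd_add, map_add]; abel
        · simp }
  d_mem i m hm := ⟨add_mem (G.d_mem _ _ hm.1) (lin_mem φ (sign_mem hm.2)), P.d_mem _ _ hm.2⟩
  d_d m := by
    refine Prod.ext ?_ (P.d_d _)
    have := lin_d φ (P.sign m.2)
    change G.d (G.d m.1 + lin φ (P.sign m.2)) + lin φ (P.sign (P.d m.2)) = 0
    rw [map_add, G.d_d, sign_d, map_neg, this]
    simp
  leibniz i a m ha := by
    refine Prod.ext ?_ (P.leibniz i a _ ha)
    change G.d (a • m.1) + lin φ (P.sign (a • m.2)) =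
      A.d a • m.1 + i.negOnePow • (a • (G.d m.1 + lin φ (P.sign m.2)))
    rw [G.leibniz i a _ ha, sign_smul, map_smul, sign_of_mem (M := self A) ha, smul_add, smul_add,
      Units.smul_def, smul_assoc, add_assoc]

variable (φ : P ⟶ shift 1 G)

lemma twist_d (g : G.carrier) (p : P.carrier) :
    (twist φ).d (g, p) = (G.d g + lin φ (P.sign p), P.d p) := rfl

lemma twist_sign (x : G.carrier × P.carrier) : (twist φ).sign x = (G.sign x.1, P.sign x.2) := by
  induction x using (homogeneous_induction (M := twist φ)) with
  | zero => simp; rfl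
  | hom i x hx =>
    rw [sign_of_mem (M := twist φ) hx, sign_of_mem hx.1, sign_of_mem hx.2]
    rfl
  | add m m' h h' => rw [map_add, h, h']; simp

/-- The inclusion of `G` in an extension by `G`. -/
def twistInl : G ⟶ twist φ :=
  (⟨LinearMap.inl _ _ _, fun _ _ h => ⟨h, zero_mem _⟩, fun m => by
    refine Prod.ext ?_ ?_ <;> simp⟩ : Hom G (twist φ))

/-- The projection of an extension to its quotient. -/
def twistSnd : twist φ ⟶ P :=
  (⟨LinearMap.snd _ _ _, fun _ _ h => h.2, fun _ => rfl⟩ : Hom (twist φ) P)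

/-- The mapping cone of `f : G ⟶ M`; its elements are pairs `(m, g)`. -/
abbrev cone (f : G ⟶ M) : DGModule A := twist (shiftMap 1 f)

lemma cone_d (f : G ⟶ M) (m : M.carrier) (g : G.carrier) :
    (cone f).d (m, g) = (M.d m - lin f (G.sign g), G.d g) := by
  rw [twist_d, sign_shift_one, map_neg, sub_eq_add_neg, lin_shiftMap]

/-- The inclusion of the target in the mapping cone. -/
abbrev coneInl (f : G ⟶ M) : M ⟶ cone f := twistInl _

end Twist

/-! ### Direct sums -/

section Coprod
open scoped Classical

variable {J : Type u} (N : J → DGModule A)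

/-- The direct sum of a family of DG modules. -/
abbrev coprod : DGModule A where
  carrier := Π₀ j, (N j).carrier
  gr i :=
    { carrier := {x | ∀ j, x j ∈ (N j).gr i}
      add_mem' := fun hx hy j => add_mem (hx j) (hy j)
      zero_mem' := fun j => zero_mem _
      neg_mem' := fun hx j => neg_mem (hx j) }
  decomposition := decompositionOfProj _
    (fun i => DFinsupp.mapRange.addMonoidHom fun j => (N j).component i)
    (fun i m hm => DFinsupp.ext fun j => by simpa using component_of_mem (hm j))
    (fun i j h m hm => DFinsupp.ext fun l => by simpa using component_of_mem_ne (hm l) h)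
    (fun m => by
      induction m using DFinsupp.induction with
      | h0 => exact zero_mem _
      | ha j x f _ _ h =>
        refine AddSubgroup.add_mem _ ?_ h
        clear * -
        induction x using homogeneous_induction with
        | zero => rw [DFinsupp.single_zero]; exact zero_mem _
        | hom i m hm =>
          refine AddSubgroup.mem_iSup_of_mem i fun l => ?_
          by_cases h : j = l
          · subst h; simpa using hm
          · rw [DFinsupp.single_eq_of_ne (Ne.symm h)]; exact zero_mem _
        | add x y hx hy => rw [DFinsupp.single_add]; exact add_mem hx hy)
  smul_mem i j a m ha hm := fun l => (N l).smul_mem _ _ _ _ ha (hm l)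
  d := DFinsupp.mapRange.addMonoidHom fun j => (N j).d
  d_mem i m hm := fun l => by simpa using (N l).d_mem _ _ (hm l)
  d_d m := DFinsupp.ext fun j => by simpa using (N j).d_d _
  leibniz i a m ha := DFinsupp.ext fun j => by
    simpa [Units.smul_def] using (N j).leibniz i a (m j) ha

/-- The inclusion of a summand. -/
def coprodι (j : J) : N j ⟶ coprod N :=
  (⟨DFinsupp.lsingle (R := A.carrier) (M := fun j => (N j).carrier) j, fun i m hm l => by
      by_cases h : j = l
      · subst h; simpa using hm
      · rw [DFinsupp.lsingle_apply, DFinsupp.single_eq_of_ne (Ne.symm h)]; exact zero_mem _,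
    fun m => by simp [coprod]⟩ : Hom (N j) (coprod N))

/-- The projection to a summand. -/
def coprodπ (j : J) : coprod N ⟶ N j :=
  (⟨DFinsupp.lapply (R := A.carrier) (M := fun j => (N j).carrier) j, fun _ _ hm => hm j, fun _ => rfl⟩ : Hom (coprod N) (N j))

variable {N}

@[simp] lemma coprodπ_ι (j : J) (x : (N j).carrier) :
    lin (coprodπ N j) (lin (coprodι N j) x) = x :=
  DFinsupp.single_eq_same (β := fun j => (N j).carrier)

lemma coprodπ_ι_ne {i j : J} (h : i ≠ j) (x : (N i).carrier) :
    lin (coprodπ N j) (lin (coprodι N i) x) = 0 :=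
  DFinsupp.single_eq_of_ne (β := fun j => (N j).carrier) (Ne.symm h)

lemma coprod_ext {x y : (coprod N).carrier}
    (h : ∀ j, lin (coprodπ N j) x = lin (coprodπ N j) y) : x = y :=
  DFinsupp.ext h

lemma coprod_induction {p : (coprod N).carrier → Prop} (x : (coprod N).carrier) (zero : p 0)
    (ι : ∀ j x, p (lin (coprodι N j) x)) (add : ∀ x y, p x → p y → p (x + y)) : p x :=
  DFinsupp.induction x zero fun j b f _ _ hf => add _ f (ι j b) hf

lemma eq_sum_coprodι (x : (coprod N).carrier) :
    ∃ s : Finset J, x = ∑ j ∈ s, lin (coprodι N j) (lin (coprodπ N j) x) :=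
  ⟨DFinsupp.support x, (DFinsupp.sum_single (β := fun j => (N j).carrier) (f := x)).symm⟩

/-- The linear map on a direct sum with given restrictions. -/
def coprodLin {C : Type*} [AddCommGroup C] [Module A.carrier C]
    (h : ∀ j, (N j).carrier →ₗ[A.carrier] C) : (coprod N).carrier →ₗ[A.carrier] C :=
  DFinsupp.lsum ℕ h

@[simp] lemma coprodLin_ι {C : Type*} [AddCommGroup C] [Module A.carrier C]
    (h : ∀ j, (N j).carrier →ₗ[A.carrier] C) (j : J) (x : (N j).carrier) :
    coprodLin h (lin (coprodι N j) x) = h j x :=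
  DFinsupp.lsum_single (M := fun j => (N j).carrier) ..

lemma coprod_addHom_ext {B : Type*} [AddCommGroup B] {f g : (coprod N).carrier →+ B}
    (h : ∀ j x, f (lin (coprodι N j) x) = g (lin (coprodι N j) x)) : f = g := by
  refine AddMonoidHom.ext fun x => ?_
  induction x using coprod_induction with
  | zero => simp
  | ι j x => exact h j x
  | add x y hx hy => rw [map_add, map_add, hx, hy]

lemma coprod_hom_ext {f g : coprod N ⟶ M} (h : ∀ j, coprodι N j ≫ f = coprodι N j ≫ g) :
    f = g := by
  refine hom_ext (LinearMap.ext fun x => DFunLike.congr_fun (coprod_addHom_ext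
    (f := (lin f).toAddMonoidHom) (g := (lin g).toAddMonoidHom) fun j x => ?_) x)
  exact congrArg (fun t => lin t x) (h j)

/-- The morphism from a direct sum with given restrictions. -/
def coprodDesc (f : ∀ j, N j ⟶ M) : coprod N ⟶ M :=
  (⟨coprodLin fun j => lin (f j), fun i x hx => by
      obtain ⟨s, hs⟩ := eq_sum_coprodι x
      rw [hs, map_sum]
      exact sum_mem fun j _ => by
        rw [coprodLin_ι]; exact lin_mem _ (hx j),
    fun x => by
      refine DFunLike.congr_fun (coprod_addHom_ext
        (f := (coprodLin (A := A) fun j => lin (f j)).toAddMonoidHom.comp (coprod N).d)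
        (g := M.d.comp (coprodLin (A := A) fun j => lin (f j)).toAddMonoidHom) fun j x => ?_) x
      change coprodLin (fun j => lin (f j)) ((coprod N).d (lin (coprodι N j) x)) =
        M.d (coprodLin (fun j => lin (f j)) (lin (coprodι N j) x))
      rw [← lin_d, coprodLin_ι, coprodLin_ι, lin_d]⟩ : Hom (coprod N) M)

@[simp]
lemma coprodι_desc (f : ∀ j, N j ⟶ M) (j : J) : coprodι N j ≫ coprodDesc f = f j :=
  hom_ext (LinearMap.ext fun x => coprodLin_ι (fun j => lin (f j)) j x)

@[simp] lemma coprodDesc_ι_apply (f : ∀ j, N j ⟶ M) (j : J) (x : (N j).carrier) :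
    lin (coprodDesc f) (lin (coprodι N j) x) = lin (f j) x :=
  coprodLin_ι (fun j => lin (f j)) j x

end Coprod

end DGModule

namespace DGModule
variable {k : Type v} [Field k] {A : DGAlgebra.{v, u} k} {M N P G : DGModule A}

@[simp] lemma lin_sub (f g : M ⟶ N) : lin (f - g) = lin f - lin g := by
  rw [sub_eq_add_neg, lin_add, lin_neg, ← sub_eq_add_neg]

/-! ### Quasi-isomorphisms in terms of cocycles and boundaries -/

section Cohomology

variable (M) in
/-- A DG module is acyclic if its cohomology vanishes. -/
def IsAcyclic : Prop := ∀ m, M.d m = 0 → ∃ m', M.d m' = m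

/-- The map induced on cohomology is zero. -/
def IsGhost (f : M ⟶ N) : Prop := ∀ m, M.d m = 0 → ∃ n, N.d n = lin f m

/-- The map induced on cohomology is surjective. -/
def CohomologySurjective (f : M ⟶ N) : Prop :=
  ∀ n, N.d n = 0 → ∃ m, M.d m = 0 ∧ ∃ n', N.d n' = n - lin f m

lemma mk_eq_zero_iff (m : M.cocycles) :
    (Submodule.Quotient.mk m : M.Cohomology) = 0 ↔ ∃ y, M.d y = m := by
  rw [Submodule.Quotient.mk_eq_zero]; rfl

lemma surjective_cohomologyMap_iff (f : M ⟶ N) :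
    Function.Surjective (cohomologyMap f) ↔ CohomologySurjective f := by
  constructor
  · intro h n hn
    obtain ⟨x, hx⟩ := h (Submodule.Quotient.mk ⟨n, hn⟩)
    obtain ⟨⟨m, hm⟩, rfl⟩ := Submodule.Quotient.mk_surjective _ x
    refine ⟨m, hm, ?_⟩
    have := (Submodule.Quotient.eq _).1 hx.symm
    exact this
  · intro h y
    obtain ⟨⟨n, hn⟩, rfl⟩ := Submodule.Quotient.mk_surjective _ y
    obtain ⟨m, hm, hy⟩ := h n hn
    refine ⟨Submodule.Quotient.mk ⟨m, hm⟩, ?_⟩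
    symm
    exact (Submodule.Quotient.eq _).2 hy

lemma injective_cohomologyMap_iff (f : M ⟶ N) :
    Function.Injective (cohomologyMap f) ↔
      ∀ m, M.d m = 0 → (∃ n, N.d n = lin f m) → ∃ m', M.d m' = m := by
  rw [injective_iff_map_eq_zero]
  constructor
  · intro h m hm hn
    exact (mk_eq_zero_iff ⟨m, hm⟩).1 (h (Submodule.Quotient.mk ⟨m, hm⟩) ((mk_eq_zero_iff _).2 hn))
  · intro h x hx
    obtain ⟨⟨m, hm⟩, rfl⟩ := Submodule.Quotient.mk_surjective _ x
    exact (mk_eq_zero_iff _).2 (h m hm ((mk_eq_zero_iff _).1 hx))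

lemma isQuasiIso_iff (f : M ⟶ N) : IsQuasiIso f ↔
    (∀ m, M.d m = 0 → (∃ n, N.d n = lin f m) → ∃ m', M.d m' = m) ∧ CohomologySurjective f := by
  rw [← injective_cohomologyMap_iff, ← surjective_cohomologyMap_iff]; rfl

/-- This is what makes acyclic modules zero objects of the derived category. -/
lemma isQuasiIso_zero_of_isAcyclic (hM : M.IsAcyclic) : IsQuasiIso (0 : M ⟶ M) :=
  (isQuasiIso_iff _).2 ⟨fun m hm _ => hM m hm, fun n hn => ⟨0, map_zero _, by
    obtain ⟨n', h⟩ := hM n hn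
    exact ⟨n', by simpa using h⟩⟩⟩

lemma isAcyclic_cone {f : M ⟶ N} (hf : IsQuasiIso f) : (cone f).IsAcyclic := by
  obtain ⟨hf₁, hf₂⟩ := (isQuasiIso_iff f).1 hf
  rintro ⟨n, m⟩ h
  rw [cone_d, Prod.mk_eq_zero, sub_eq_zero] at h
  obtain ⟨h₁, h₂⟩ := h
  have hs : M.d (M.sign m) = 0 := by
    have := sign_d (M := M) m
    rwa [h₂, map_zero, eq_comm, neg_eq_zero] at this
  -- Injectivity on cohomology gives a primitive `m'` of `sign m`. The cocycle `n - f m'` is then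
  -- corrected, by surjectivity, with a cocycle `m''`.
  obtain ⟨m', hm'⟩ := hf₁ _ hs ⟨n, h₁⟩
  have h₃ : N.d (n - lin f m') = 0 := by rw [map_sub, ← lin_d, hm', h₁, sub_self]
  obtain ⟨m'', hm'', n', hn'⟩ := hf₂ _ h₃
  refine ⟨(n', -(M.sign (m' + m''))), ?_⟩
  have : M.d (M.sign (m' + m'')) = -m := by
    have := sign_d (m' + m'')
    rw [map_add, hm', hm'', add_zero, sign_sign] at this
    rw [this, neg_neg]
  rw [cone_d, map_neg, map_neg, sign_sign, map_neg, this, hn']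
  refine Prod.ext ?_ ?_
  · simp only [map_add, neg_add_rev]
    abel
  · simp

end Cohomology

/-! ### Null-homotopies -/

section Homotopy

/-- A morphism `f` is null-homotopic if `f = ∂ s + s ∂` where `s` has degree `-1`. Here
`h m = s ((-1)^{|m|} m)`, which makes `h` linear over `A`; that `h` can be taken of degree `-1`
is `NullHomotopic.exists_homogeneous`. -/
def NullHomotopic (f : M ⟶ N) : Prop :=
  ∃ h : M.carrier →ₗ[A.carrier] N.carrier, ∀ m, N.d (h m) - h (M.d m) = lin f (M.sign m)

/-- The elements on which `h` is a null-homotopy of `f`. -/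
def homotopySubmodule (h : M.carrier →ₗ[A.carrier] N.carrier) (f : M ⟶ N) :
    Submodule A.carrier M.carrier where
  carrier := {m | N.d (h m) - h (M.d m) = lin f (M.sign m)}
  add_mem' {m m'} hm hm' := by
    simp only [Set.mem_ofPred_eq, map_add] at *
    rw [← hm, ← hm']; abel
  zero_mem' := by simp
  smul_mem' a m hm := by
    simp only [Set.mem_ofPred_eq, sign_smul, d_smul, map_smul, map_add] at *
    rw [← hm, smul_sub]; abel

/-- Both sides of the homotopy equation respect degrees, so it survives replacing `h` by its part of
degree `-1`, which is still `A`-linear. -/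
lemma NullHomotopic.exists_homogeneous {f : M ⟶ N} (hf : NullHomotopic f) :
    ∃ h : M.carrier →ₗ[A.carrier] N.carrier, (∀ i, ∀ m ∈ M.gr i, h m ∈ N.gr (i - 1)) ∧
      ∀ m, N.d (h m) - h (M.d m) = lin f (M.sign m) := by
  obtain ⟨h, hh⟩ := hf
  let t : M.carrier →+ N.carrier :=
    (DirectSum.toAddMonoid fun i => ((N.component (i - 1)).comp h.toAddMonoidHom).comp
      (M.gr i).subtype).comp (DirectSum.decomposeAddEquiv M.gr).toAddMonoidHom
  have ht : ∀ i, ∀ m ∈ M.gr i, t m = N.component (i - 1) (h m) := by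
    intro i m hm
    have : DirectSum.decompose M.gr m = DirectSum.of (fun i => M.gr i) i ⟨m, hm⟩ :=
      DirectSum.decompose_of_mem M.gr hm
    change DirectSum.toAddMonoid _ (DirectSum.decompose M.gr m) = _
    rw [this, DirectSum.toAddMonoid_of]
    rfl
  have hsmul : ∀ (a : A.carrier) (m : M.carrier), t (a • m) = a • t m := by
    intro a m
    induction m using homogeneous_induction with
    | zero => simp
    | add m m' h h' => rw [smul_add, map_add, h, h', map_add, smul_add]
    | hom i m hm =>
      induction a using (homogeneous_induction (M := self A)) with
      | zero => simp
      | add a b h h' => rw [add_smul, map_add, h, h', add_smul]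
      | hom j a ha =>
        rw [ht _ _ hm, ht _ _ (M.smul_mem _ _ _ _ ha hm), map_smul, add_sub_assoc,
          component_smul ha]
  refine ⟨{ t with map_smul' := hsmul }, fun i m hm => ?_, fun m => ?_⟩
  · change t m ∈ _
    rw [ht _ _ hm]
    exact component_mem _ _
  · change N.d (t m) - t (M.d m) = _
    induction m using homogeneous_induction with
    | zero => simp
    | add m m' h h' => rw [map_add, map_add, map_add, map_add, map_add, map_add, ← h, ← h']; abel
    | hom i m hm =>
      rw [ht _ _ hm, ht _ _ (M.d_mem _ _ hm), add_sub_right_comm, ← component_d, ← map_sub, hh,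
        component_of_mem]
      simpa using lin_mem f (sign_mem hm)

lemma NullHomotopic.add {f g : M ⟶ N} (hf : NullHomotopic f) (hg : NullHomotopic g) :
    NullHomotopic (f + g) := by
  obtain ⟨h, hh⟩ := hf
  obtain ⟨h', hh'⟩ := hg
  refine ⟨h + h', fun m => ?_⟩
  rw [lin_add, LinearMap.add_apply, LinearMap.add_apply, LinearMap.add_apply, ← hh, ← hh', map_add]
  abel

lemma NullHomotopic.neg {f : M ⟶ N} (hf : NullHomotopic f) : NullHomotopic (-f) := by
  obtain ⟨h, hh⟩ := hf
  refine ⟨-h, fun m => ?_⟩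
  rw [lin_neg, LinearMap.neg_apply, LinearMap.neg_apply, LinearMap.neg_apply, ← hh, map_neg]
  abel

lemma nullHomotopic_zero : NullHomotopic (0 : M ⟶ N) := ⟨0, fun m => by simp⟩

lemma NullHomotopic.comp {f : M ⟶ N} (hf : NullHomotopic f) (g : N ⟶ P) :
    NullHomotopic (f ≫ g) := by
  obtain ⟨h, hh⟩ := hf
  refine ⟨(lin g).comp h, fun m => ?_⟩
  rw [lin_comp, LinearMap.comp_apply, LinearMap.comp_apply, LinearMap.comp_apply, ← hh, map_sub,
    lin_d]

lemma NullHomotopic.precomp {g : N ⟶ P} (hg : NullHomotopic g) (f : M ⟶ N) :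
    NullHomotopic (f ≫ g) := by
  obtain ⟨h, hh⟩ := hg
  refine ⟨h.comp (lin f), fun m => ?_⟩
  rw [lin_comp, LinearMap.comp_apply, LinearMap.comp_apply, LinearMap.comp_apply, ← sign_lin, ← hh,
    lin_d]

lemma NullHomotopic.isGhost {f : M ⟶ N} (hf : NullHomotopic f) : IsGhost f := by
  obtain ⟨h, hh⟩ := hf
  intro m hm
  have := hh (M.sign m)
  have hs : M.d (M.sign m) = 0 := by
    have := sign_d m
    rwa [hm, map_zero, eq_comm, neg_eq_zero] at this
  rw [hs, map_zero, sub_zero, sign_sign] at this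
  exact ⟨_, this⟩

/-- A null-homotopy of `δ ≫ f` extends `f` to the mapping cone of `δ`. -/
lemma exists_extension_cone (δ : M ⟶ N) (f : N ⟶ P) (hf : NullHomotopic (δ ≫ f)) :
    ∃ w : cone δ ⟶ P, coneInl δ ≫ w = f := by
  obtain ⟨h, hdeg, hh⟩ := hf.exists_homogeneous
  -- The homotopy equation for `δ ≫ f` is exactly the condition that the map given by `f` on `N` and
  -- by `-h` on `M` commutes with the differential of the cone.
  refine ⟨(⟨(lin f).coprod (-h), fun i x hx => ?_, fun x => ?_⟩ : Hom (cone δ) P), ?_⟩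
  · have := hdeg _ _ hx.2
    rw [add_sub_cancel_right] at this
    exact add_mem (lin_mem f hx.1) (neg_mem this)
  · obtain ⟨n, m⟩ := x
    have := hh m
    simp only [lin_comp, LinearMap.comp_apply] at this
    rw [cone_d]
    simp only [LinearMap.coprod_apply, map_sub, map_add, LinearMap.neg_apply, ← this, lin_d,
      map_neg]
    abel
  · refine hom_ext (LinearMap.ext fun n => ?_)
    change lin f n + -h 0 = lin f n
    simp

/-- If `u ≫ coneInl f` is null-homotopic, then `u` factors through `f` up to homotopy. -/
lemma exists_factor_of_nullHomotopic (u : P ⟶ N) (f : M ⟶ N)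
    (hu : NullHomotopic (u ≫ coneInl f)) : ∃ g : P ⟶ M, NullHomotopic (u - g ≫ f) := by
  obtain ⟨h, hdeg, hh⟩ := hu.exists_homogeneous
  have h₁ : ∀ x, (cone f).d (h x) = (N.d (h x).1 - lin f (M.sign (h x).2), M.d (h x).2) :=
    fun x => cone_d f _ _
  have h₂ : ∀ x, M.d (h x).2 - (h (P.d x)).2 = 0 := fun x => congrArg Prod.snd (hh x)
  have h₃ : ∀ x, N.d (h x).1 - lin f (M.sign (h x).2) - (h (P.d x)).1 = lin u (P.sign x) :=
    fun x => by
      have := congrArg Prod.fst (hh x)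
      rwa [h₁] at this
  -- A homotopy into the cone has two components: up to sign, the second is a morphism to `M`, and
  -- the first is the homotopy between `u` and `g ≫ f`.
  let g : P ⟶ M := (⟨-(LinearMap.snd _ _ _).comp h, fun i x hx => by
      have : (h x).2 ∈ M.gr (i - 1 + 1) := (hdeg _ _ hx).2
      rw [sub_add_cancel] at this
      exact neg_mem this, fun x => by
      change -(h (P.d x)).2 = M.d (-(h x).2)
      rw [map_neg, ← sub_eq_zero.1 (h₂ x)]⟩ : Hom P M)
  refine ⟨g, (LinearMap.fst _ _ _).comp h, fun x => ?_⟩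
  have h₄ : lin g (P.sign x) = -M.sign (h x).2 := by
    rw [← sign_lin]
    change M.sign (-(h x).2) = _
    rw [map_neg]
  rw [lin_sub, LinearMap.sub_apply, lin_comp]
  change N.d (h x).1 - (h (P.d x)).1 = lin u (P.sign x) - lin f (lin g (P.sign x))
  rw [h₄, ← h₃ x, map_neg]
  abel

end Homotopy

/-! ### K-projective modules -/

section KProjective

variable (P) in
/-- A DG module is K-projective if all morphisms to acyclic DG modules are null-homotopic. -/
def IsKProjective : Prop := ∀ N : DGModule A, N.IsAcyclic → ∀ f : P ⟶ N, NullHomotopic f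

lemma IsKProjective.shift (hP : P.IsKProjective) (n : ℤ) : (shift n P).IsKProjective := by
  intro N hN f
  obtain ⟨h, hh⟩ := hP (DGModule.shift (-n) N) hN
    (⟨lin (M := DGModule.shift n P) (N := N) f,
      fun i m hm => lin_mem (M := DGModule.shift n P) f (i := i + -n) (by simpa using hm),
      lin_d (M := DGModule.shift n P) f⟩ :
      Hom P (DGModule.shift (-n) N))
  refine ⟨(n.negOnePow : ℤ) • h, fun m => ?_⟩
  have := hh m
  change N.d (h m) - h (P.d m) = lin f (P.sign m) at this
  rw [sign_shift, Units.smul_def, map_zsmul, ← this, smul_sub, LinearMap.smul_apply,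
    LinearMap.smul_apply, map_zsmul]

-- A morphism out of `A` is determined by the cocycle `f 1`. If `y` is a primitive of it, then `a ↦
-- a • y` is a null-homotopy.
variable (A) in
lemma isKProjective_self : (self A).IsKProjective := by
  intro N hN f
  have h1 : (1 : A.carrier) ∈ (self A).gr 0 :=
    (SetLike.GradedOne.one_mem : (1 : A.carrier) ∈ A.gr 0)
  have hd : A.d 1 = 0 := A.d_one
  obtain ⟨y, hy⟩ := hN (lin f (1 : A.carrier)) (by
    have := lin_d f (1 : A.carrier)
    rw [← this]
    exact (congrArg (lin f) hd).trans (map_zero _))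
  let h : A.carrier →ₗ[A.carrier] N.carrier := LinearMap.toSpanSingleton _ _ y
  have hmem : (1 : A.carrier) ∈ homotopySubmodule (M := self A) h f := by
    change N.d ((1 : A.carrier) • y) - (A.d 1) • y = lin f ((self A).sign (1 : A.carrier))
    rw [sign_of_mem h1, hd]
    simp [hy]
  refine ⟨h, fun m => ?_⟩
  have := (homotopySubmodule (M := self A) h f).smul_mem m hmem
  rwa [smul_eq_mul, mul_one] at this

lemma nullHomotopic_coprod {J : Type u} {N : J → DGModule A} {f : coprod N ⟶ M}
    (hf : ∀ j, NullHomotopic (coprodι N j ≫ f)) : NullHomotopic f := by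
  choose h hh using hf
  refine ⟨coprodLin h, fun m => ?_⟩
  change m ∈ homotopySubmodule (coprodLin h) f
  induction m using coprod_induction with
  | zero => exact zero_mem _
  | add x y hx hy => exact add_mem hx hy
  | ι j x =>
    change M.d (coprodLin h (lin (coprodι N j) x)) - coprodLin h ((coprod N).d _) = _
    rw [← lin_d, coprodLin_ι, coprodLin_ι, hh, sign_lin]
    rfl

lemma isKProjective_coprod {J : Type u} {N : J → DGModule A} (hN : ∀ j, (N j).IsKProjective) :
    (coprod N).IsKProjective :=
  fun _ hM _ => nullHomotopic_coprod fun j => hN j _ hM _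

/-- After choosing a null-homotopy `h` of the restriction to `G`, the remaining obstruction `p ↦ f
(0, p) + h (φ p)` is a morphism out of `P`. A null-homotopy of it supplies the other component. -/
lemma isKProjective_twist (φ : P ⟶ shift 1 G) (hG : G.IsKProjective) (hP : P.IsKProjective) :
    (twist φ).IsKProjective := by
  intro N hN f
  obtain ⟨h, hdeg, hh⟩ := (hG N hN (twistInl φ ≫ f)).exists_homogeneous
  have hh' : ∀ g, N.d (h g) - h (G.d g) = lin f (G.sign g, 0) := hh
  have hφ : ∀ p, lin φ (P.sign p) = -G.sign (lin φ p) := fun p => by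
    rw [← sign_lin, sign_shift_one]
  have hφd : ∀ p, lin φ (P.d p) = G.d (lin φ p) := fun p => lin_d φ p
  let r : P ⟶ N := (⟨(lin f).comp (LinearMap.inr _ _ _) + h.comp (lin (N := DGModule.shift 1 G) φ), fun i p hp => by
      refine add_mem (lin_mem f ⟨zero_mem _, hp⟩) ?_
      have := hdeg _ _ (lin_mem φ hp)
      rw [add_sub_cancel_right] at this
      exact this, fun p => by
      change lin f (0, P.d p) + h (lin φ (P.d p)) = N.d (lin f (0, p) + h (lin φ p))
      have h₁ := hh' (lin φ p)
      rw [map_add, ← lin_d f, twist_d, map_zero, zero_add, hφd, sub_eq_iff_eq_add.1 h₁, ← add_assoc,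
        ← map_add, hφ]
      simp⟩ : Hom P N)
  obtain ⟨h', hh₂⟩ := hP N hN r
  refine ⟨h.coprod h', fun ⟨g, p⟩ => ?_⟩
  have e₁ := hh' g
  have e₂ : N.d (h' p) - h' (P.d p) = lin f (0, P.sign p) + h (lin φ (P.sign p)) := hh₂ p
  rw [twist_sign, twist_d]
  change N.d (h g + h' p) - (h (G.d g + lin φ (P.sign p)) + h' (P.d p)) = lin f (G.sign g, P.sign p)
  have e₃ : lin f (G.sign g, P.sign p) = lin f (G.sign g, 0) + lin f (0, P.sign p) := by
    rw [← map_add]; simp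
  rw [e₃, ← e₁, eq_sub_of_add_eq e₂.symm, map_add, map_add]
  abel

lemma isKProjective_cone (f : M ⟶ N) (hM : M.IsKProjective) (hN : N.IsKProjective) :
    (cone f).IsKProjective :=
  isKProjective_twist _ hN (hM.shift 1)

lemma IsKProjective.exists_lift (hP : P.IsKProjective) {s : M ⟶ N} (hs : IsQuasiIso s)
    (f : P ⟶ N) : ∃ g : P ⟶ M, NullHomotopic (f - g ≫ s) :=
  exists_factor_of_nullHomotopic f s (hP _ (isAcyclic_cone hs) _)

/-- A null-homotopy `h` of `f ≫ s` is the same as a morphism `(h, f)` to a shift of the cone of `s`.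
That cone is acyclic, and the second component of a null-homotopy of `(h, f)` is one of `f`. -/
lemma IsKProjective.nullHomotopic_of_comp (hP : P.IsKProjective) {s : M ⟶ N} (hs : IsQuasiIso s)
    (f : P ⟶ M) (hf : NullHomotopic (f ≫ s)) : NullHomotopic f := by
  obtain ⟨h, hdeg, hh⟩ := hf.exists_homogeneous
  let w : P ⟶ DGModule.shift (-1) (cone s) := (⟨h.prod (lin (N := M) f), fun i p hp =>
      ⟨hdeg _ _ hp, by
        change lin f p ∈ M.gr (i + -1 + 1)
        simpa using lin_mem f hp⟩, fun p => by
      change (h (P.d p), lin f (P.d p)) = (cone s).d (h p, lin f p)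
      rw [cone_d, lin_d, sign_lin]
      have := hh p
      rw [lin_comp, LinearMap.comp_apply] at this
      rw [← this, sub_sub_cancel]⟩ : Hom P (DGModule.shift (-1) (cone s)))
  obtain ⟨K, hK⟩ := hP (DGModule.shift (-1) (cone s)) (isAcyclic_cone hs) w
  exact ⟨(LinearMap.snd _ _ _).comp K, fun p => congrArg Prod.snd (hK p)⟩

end KProjective

end DGModule

namespace DGModule
variable {k : Type v} [Field k] {A : DGAlgebra.{v, u} k} {M N P G : DGModule A}

/-! ### Morphisms in the derived category out of K-projective modules -/

section Localization

variable (A) in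
/-- The localization functor `C(A) ⥤ D(A)`. -/
abbrev toDerivedCat : DGModule A ⥤ DerivedCat A := (quasiIso A).Q

instance : (toDerivedCat A).Additive := LocalizationAdd.Q_additive

lemma isIso_map {f : M ⟶ N} (hf : IsQuasiIso f) : IsIso ((toDerivedCat A).map f) :=
  MorphismProperty.Q_inverts (quasiIso A) f hf

/-- The zero endomorphism is a quasi-isomorphism, hence is invertible after localization, and an
object with an invertible zero endomorphism is zero. -/
lemma map_id_eq_zero_of_isAcyclic (hM : M.IsAcyclic) : (toDerivedCat A).map (𝟙 M) = 0 := by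
  have := isIso_map (isQuasiIso_zero_of_isAcyclic hM)
  have h : (toDerivedCat A).map (0 : M ⟶ M) = 0 := Functor.map_zero _ _ _
  rw [CategoryTheory.Functor.map_id, ← IsIso.hom_inv_id ((toDerivedCat A).map (0 : M ⟶ M))]
  conv_lhs => enter [1]; rw [h]
  exact zero_comp

lemma isQuasiIso_id : IsQuasiIso (𝟙 M) := isQuasiIso_of_isIso _

/-- Null-homotopic morphisms become zero in the derived category. -/
lemma NullHomotopic.map_eq_zero {f : M ⟶ N} (hf : NullHomotopic f) :
    (toDerivedCat A).map f = 0 := by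
  -- A null-homotopic morphism factors through the cone of the identity, which is acyclic.
  obtain ⟨w, hw⟩ := exists_extension_cone (𝟙 M) f (by rwa [Category.id_comp])
  rw [← hw, ← Category.id_comp w, Functor.map_comp, Functor.map_comp,
    map_id_eq_zero_of_isAcyclic (isAcyclic_cone isQuasiIso_id), zero_comp, comp_zero]

lemma NullHomotopic.map_eq {f g : M ⟶ N} (hf : NullHomotopic (f - g)) :
    (toDerivedCat A).map f = (toDerivedCat A).map g := by
  rw [← sub_eq_zero, ← Functor.map_sub, hf.map_eq_zero]

/-- The subgroup of null-homotopic morphisms. -/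
def nullHomotopicSubgroup (P N : DGModule A) : AddSubgroup (P ⟶ N) where
  carrier := {f : P ⟶ N | NullHomotopic f}
  add_mem' := NullHomotopic.add
  zero_mem' := nullHomotopic_zero
  neg_mem' := NullHomotopic.neg

variable (P) in
/-- The functor of homotopy classes of morphisms from `P`. -/
def homotopyClasses : DGModule A ⥤ AddCommGrpCat.{u} where
  obj N := AddCommGrpCat.of ((P ⟶ N) ⧸ nullHomotopicSubgroup P N)
  map {N N'} f := AddCommGrpCat.ofHom (QuotientAddGroup.map _ _
    (Preadditive.rightComp P f) fun g hg => NullHomotopic.comp (f := g) hg f)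
  map_id N := by
    refine AddCommGrpCat.hom_ext (AddMonoidHom.ext fun x => ?_)
    obtain ⟨g, rfl⟩ := QuotientAddGroup.mk_surjective x
    exact congrArg (QuotientAddGroup.mk (s := nullHomotopicSubgroup P N)) (Category.comp_id g)
  map_comp {_ _ N} f f' := by
    refine AddCommGrpCat.hom_ext (AddMonoidHom.ext fun x => ?_)
    obtain ⟨g, rfl⟩ := QuotientAddGroup.mk_surjective x
    exact congrArg (QuotientAddGroup.mk (s := nullHomotopicSubgroup P N))
      (Category.assoc g f f').symm

lemma IsKProjective.isInvertedBy_homotopyClasses (hP : P.IsKProjective) :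
    (quasiIso A).IsInvertedBy (homotopyClasses P) := by
  intro M N s hs
  rw [ConcreteCategory.isIso_iff_bijective]
  constructor
  · refine (injective_iff_map_eq_zero ((homotopyClasses P).map s).hom).2 fun x hx => ?_
    obtain ⟨g, rfl⟩ := QuotientAddGroup.mk_surjective x
    have : NullHomotopic (g ≫ s) := (QuotientAddGroup.eq_zero_iff _).1 hx
    exact (QuotientAddGroup.eq_zero_iff _).2 (hP.nullHomotopic_of_comp hs g this)
  · intro y
    obtain ⟨f, rfl⟩ := QuotientAddGroup.mk_surjective y
    obtain ⟨g, hg⟩ := hP.exists_lift hs f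
    refine ⟨QuotientAddGroup.mk g, QuotientAddGroup.eq.2 ?_⟩
    rw [neg_add_eq_sub]
    exact hg

/-- Homotopy classes of maps out of `P` form a functor that inverts quasi-isomorphisms, so it
descends to the derived category. There it is evaluated at the class of `𝟙 P`, as in the Yoneda
lemma. -/
lemma IsKProjective.nullHomotopic_of_map_eq_zero (hP : P.IsKProjective) {f : P ⟶ N}
    (hf : (toDerivedCat A).map f = 0) : NullHomotopic f := by
  have h₀ : (toDerivedCat A).map f = (toDerivedCat A).map (0 : P ⟶ N) :=
    hf.trans (Functor.map_zero _ _ _).symm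
  let L := Localization.Construction.lift (homotopyClasses P) hP.isInvertedBy_homotopyClasses
  have hL : toDerivedCat A ⋙ L = homotopyClasses P := Localization.Construction.fac _ _
  have h₁ : (toDerivedCat A ⋙ L).map f = (toDerivedCat A ⋙ L).map (0 : P ⟶ N) :=
    congrArg L.map h₀
  rw [hL] at h₁
  have h₂ := ConcreteCategory.congr_hom h₁ (QuotientAddGroup.mk (𝟙 P))
  have h₃ : (QuotientAddGroup.mk (𝟙 P ≫ f) : (P ⟶ N) ⧸ nullHomotopicSubgroup P N) =
    QuotientAddGroup.mk (𝟙 P ≫ 0) := h₂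
  rw [comp_zero, Category.id_comp] at h₃
  exact (QuotientAddGroup.eq_zero_iff _).1 h₃

/-- All morphisms in the derived category from a K-projective DG module come from `C(A)`. -/
lemma IsKProjective.exists_map_eq (hP : P.IsKProjective)
    (φ : (toDerivedCat A).obj P ⟶ (toDerivedCat A).obj N) :
    ∃ f : P ⟶ N, (toDerivedCat A).map f = φ := by
  let F : ∀ X : DerivedCat A, Set ((toDerivedCat A).obj P ⟶ X) := fun X =>
    {φ | ∃ f : P ⟶ LocalizationAdd.pt _ X, LocalizationAdd.ofQ ((toDerivedCat A).map f) = φ}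
  -- Every morphism of the localization is a composite of images of morphisms and of formal inverses
  -- of quasi-isomorphisms. So it is enough that composing with either kind stays among the maps
  -- coming from `C(A)`; for the inverses this is lifting along a quasi-isomorphism.
  let S : MorphismProperty (DerivedCat A) := fun X Y ψ => ∀ φ ∈ F X, φ ≫ ψ ∈ F Y
  have : S.IsStableUnderComposition := ⟨fun a b ha hb φ hφ => by
    rw [← Category.assoc]
    exact hb _ (ha _ hφ)⟩
  have hS : S = ⊤ := Localization.Construction.morphismProperty_eq_top S
    (fun X Y g => by
      rintro _ ⟨f, rfl⟩
      exact ⟨f ≫ g, (toDerivedCat A).map_comp f g⟩)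
    (fun X Y s hs => by
      rintro _ ⟨f, rfl⟩
      obtain ⟨g, hg⟩ := hP.exists_lift hs f
      refine ⟨g, ?_⟩
      have h := hg.map_eq
      rw [Functor.map_comp] at h
      exact (Iso.eq_comp_inv (Localization.Construction.wIso s hs)).2 h.symm)
  have h : S φ := by rw [hS]; trivial
  obtain ⟨f, hf⟩ := h (𝟙 _) ⟨𝟙 P, (toDerivedCat A).map_id P⟩
  exact ⟨f, hf.trans (Category.id_comp φ)⟩

end Localization

end DGModule

namespace DGModule
variable {k : Type v} [Field k] {A : DGAlgebra.{v, u} k} {M N P G : DGModule A}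

lemma d_sign (m : M.carrier) : M.d (M.sign m) = -M.sign (M.d m) := by
  rw [sign_d, neg_neg]

lemma cone_d_neg_sign (f : G ⟶ M) (x : G.carrier) :
    (cone f).d (0, -G.sign x) = (lin f x, G.sign (G.d x)) := by
  rw [cone_d, map_neg, sign_sign, map_neg, map_neg, d_sign, map_zero, zero_sub, neg_neg, neg_neg]

/-! ### Mapping telescopes of sequences -/

section Telescope

variable (G : ℕ → DGModule A)

/-- The direct sum of a sequence of DG modules. -/
abbrev seqSum : DGModule A := coprod fun n : ULift.{u} ℕ => G n.down

/-- The inclusion of a summand in the direct sum of a sequence. -/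
def seqι (n : ℕ) : G n ⟶ seqSum G := coprodι (fun n : ULift.{u} ℕ => G n.down) ⟨n⟩

/-- The projection of the direct sum of a sequence to a summand. -/
def seqπ (n : ℕ) : seqSum G ⟶ G n := coprodπ (fun n : ULift.{u} ℕ => G n.down) ⟨n⟩

variable {G}

@[simp] lemma seqι_π (n : ℕ) : seqι G n ≫ seqπ G n = 𝟙 _ :=
  hom_ext (LinearMap.ext fun x => coprodπ_ι (N := fun n : ULift.{u} ℕ => G n.down) ⟨n⟩ x)

lemma seqι_π_ne {m n : ℕ} (h : m ≠ n) : seqι G m ≫ seqπ G n = 0 :=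
  hom_ext (LinearMap.ext fun x => coprodπ_ι_ne (N := fun n : ULift.{u} ℕ => G n.down)
    (i := ⟨m⟩) (j := ⟨n⟩) (fun e => h (congrArg ULift.down e)) x)

lemma seq_hom_ext {f g : seqSum G ⟶ M} (h : ∀ n, seqι G n ≫ f = seqι G n ≫ g) : f = g :=
  coprod_hom_ext fun n => h n.down

lemma seq_eq_sum (x : (seqSum G).carrier) :
    ∃ s : Finset ℕ, x = ∑ n ∈ s, lin (seqι G n) (lin (seqπ G n) x) := by
  classical
  obtain ⟨s, hs⟩ := eq_sum_coprodι x
  refine ⟨s.map ⟨ULift.down, ULift.down_injective⟩, ?_⟩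
  rw [Finset.sum_map]
  exact hs

/-- The morphism from the direct sum of a sequence with given restrictions. -/
def seqDesc (f : ∀ n, G n ⟶ M) : seqSum G ⟶ M :=
  coprodDesc fun n : ULift.{u} ℕ => f n.down

@[simp] lemma seqι_desc (f : ∀ n, G n ⟶ M) (n : ℕ) : seqι G n ≫ seqDesc f = f n :=
  coprodι_desc _ _

variable (t : ∀ n, G n ⟶ G (n + 1))

/-- The difference of the identity and the shift map of a sequence. -/
def idSubShift : seqSum G ⟶ seqSum G :=
  seqDesc fun n => seqι G n - t n ≫ seqι G (n + 1)

lemma seqι_idSubShift (n : ℕ) :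
    seqι G n ≫ idSubShift t = seqι G n - t n ≫ seqι G (n + 1) := seqι_desc _ _

lemma idSubShift_π_zero : idSubShift t ≫ seqπ G 0 = seqπ G 0 := by
  refine seq_hom_ext fun n => ?_
  rw [← Category.assoc, seqι_idSubShift, Preadditive.sub_comp, Category.assoc,
    seqι_π_ne (Nat.succ_ne_zero n), comp_zero, sub_zero]

lemma idSubShift_π_succ (n : ℕ) :
    idSubShift t ≫ seqπ G (n + 1) = seqπ G (n + 1) - seqπ G n ≫ t n := by
  refine seq_hom_ext fun m => ?_
  rw [← Category.assoc, seqι_idSubShift, Preadditive.sub_comp, Preadditive.comp_sub,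
    Category.assoc, ← Category.assoc _ (seqπ G n)]
  congr 1
  by_cases h : m = n
  · subst h
    rw [seqι_π, seqι_π, Category.comp_id, Category.id_comp]
  · rw [seqι_π_ne h, seqι_π_ne (by omega), zero_comp, comp_zero]

/-- In components the hypothesis reads `x₀ = d y₀` and `xₙ₊₁ - t xₙ = d yₙ₊₁`, so primitives of the
`xₙ` are found recursively. -/
lemma idSubShift_injective (x : (seqSum G).carrier)
    (h : ∃ y, (seqSum G).d y = lin (idSubShift t) x) : ∃ x', (seqSum G).d x' = x := by
  obtain ⟨y, hy⟩ := h
  have key : ∀ n, ∃ z, (G n).d z = lin (seqπ G n) x := by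
    intro n
    induction n with
    | zero =>
      refine ⟨lin (seqπ G 0) y, ?_⟩
      rw [← lin_d, hy, ← LinearMap.comp_apply, ← lin_comp, idSubShift_π_zero]
    | succ n ih =>
      obtain ⟨z, hz⟩ := ih
      refine ⟨lin (seqπ G (n + 1)) y + lin (t n) z, ?_⟩
      rw [map_add, ← lin_d, ← lin_d, hy, hz, ← LinearMap.comp_apply, ← lin_comp, idSubShift_π_succ]
      simp
  choose z hz using key
  obtain ⟨s, hs⟩ := seq_eq_sum x
  refine ⟨∑ n ∈ s, lin (seqι G n) (z n), ?_⟩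
  rw [map_sum]
  refine Eq.trans (Finset.sum_congr rfl fun n _ => ?_) hs.symm
  rw [← lin_d, hz]

/-- This allows an element to be pushed one stage up modulo the image of `idSubShift t`. -/
lemma seqι_eq (n : ℕ) (g : (G n).carrier) : lin (seqι G n) g =
    lin (seqι G (n + 1)) (lin (t n) g) + lin (idSubShift t) (lin (seqι G n) g) := by
  have := congrArg (fun f => lin f g) (seqι_idSubShift t n)
  simp only [lin_comp, LinearMap.comp_apply, lin_sub, LinearMap.sub_apply] at this
  rw [this]; abel

lemma d_seqι {n : ℕ} {g : (G n).carrier} (hg : (G n).d g = 0) :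
    (seqSum G).d (lin (seqι G n) g) = 0 := by
  rw [← lin_d, hg, map_zero]

lemma exists_eq_seqι_add_of_le {n : ℕ} (g : (G n).carrier) (hg : (G n).d g = 0) (m : ℕ)
    (h : n ≤ m) : ∃ (g' : (G m).carrier) (x : (seqSum G).carrier), (G m).d g' = 0 ∧
      (seqSum G).d x = 0 ∧ lin (seqι G n) g = lin (seqι G m) g' + lin (idSubShift t) x := by
  induction m, h using Nat.le_induction with
  | base => exact ⟨g, 0, hg, map_zero _, by simp⟩
  | succ m _ ih =>
    obtain ⟨g', x, hg', hx, e⟩ := ih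
    refine ⟨lin (t m) g', lin (seqι G m) g' + x, by rw [← lin_d, hg', map_zero],
      by rw [map_add, hx, d_seqι hg', add_zero], ?_⟩
    rw [e, map_add, ← add_assoc, ← seqι_eq]

/-- The finitely many nonzero components of a cocycle can all be pushed up to a common stage and
added there. -/
lemma exists_eq_seqι_add (y : (seqSum G).carrier) (hy : (seqSum G).d y = 0) :
    ∃ (n : ℕ) (g : (G n).carrier) (x : (seqSum G).carrier), (G n).d g = 0 ∧
      (seqSum G).d x = 0 ∧ y = lin (seqι G n) g + lin (idSubShift t) x := by
  classical
  obtain ⟨s, hs⟩ := seq_eq_sum y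
  obtain ⟨z, hz⟩ : ∃ z : ∀ n, (G n).carrier, z = fun n => lin (seqπ G n) y := ⟨_, rfl⟩
  have hπ : ∀ n, (G n).d (z n) = 0 := fun n => by rw [hz, ← lin_d, hy, map_zero]
  have hs' : y = ∑ n ∈ s, lin (seqι G n) (z n) := by rw [hz]; exact hs
  rw [hs']
  clear hs hs' hz
  induction s using Finset.induction_on with
  | empty => exact ⟨0, 0, 0, map_zero _, map_zero _, by simp⟩
  | insert a s ha ih =>
    obtain ⟨n, g, x, hg, hx, e⟩ := ih
    obtain ⟨g₁, x₁, hg₁, hx₁, e₁⟩ := exists_eq_seqι_add_of_le t g hg (max n a) (le_max_left _ _)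
    obtain ⟨g₂, x₂, hg₂, hx₂, e₂⟩ :=
      exists_eq_seqι_add_of_le t (z a) (hπ a) (max n a) (le_max_right _ _)
    refine ⟨max n a, g₁ + g₂, x₁ + x₂ + x, by rw [map_add, hg₁, hg₂, add_zero],
      by rw [map_add, map_add, hx₁, hx₂, hx]; simp, ?_⟩
    rw [Finset.sum_insert ha, e, e₁, e₂]
    simp only [map_add]
    abel

/-- If the morphisms `v n : G n ⟶ M` are compatible up to homotopy with the transition maps, if
they are jointly surjective on cohomology and if the transition maps kill the kernel of `H(v n)`,
then the mapping telescope of the `G n` is quasi-isomorphic to `M`. -/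
theorem exists_quasiIso_telescope (v : ∀ n, G n ⟶ M)
    (hv : ∀ n, NullHomotopic (v n - t n ≫ v (n + 1)))
    (hsurj : ∀ m, M.d m = 0 → ∃ n g, (G n).d g = 0 ∧ ∃ m', M.d m' = m - lin (v n) g)
    (hker : ∀ n g, (G n).d g = 0 → (∃ m, M.d m = lin (v n) g) → ∃ g', (G (n + 1)).d g' = lin (t n) g) :
    ∃ w : cone (idSubShift t) ⟶ M, IsQuasiIso w := by
  have hδ : NullHomotopic (idSubShift t ≫ seqDesc v) := by
    refine nullHomotopic_coprod fun n => ?_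
    have : seqι G n.down ≫ idSubShift t ≫ seqDesc v = v n.down - t n.down ≫ v (n.down + 1) := by
      rw [← Category.assoc, seqι_idSubShift, Preadditive.sub_comp, Category.assoc, seqι_desc,
        seqι_desc]
    exact this ▸ hv n.down
  obtain ⟨w, hw⟩ := exists_extension_cone _ _ hδ
  have hw' : ∀ y, lin w (y, 0) = lin (seqDesc v) y := fun y => by rw [← hw]; rfl
  have hv' : ∀ n g, lin (seqDesc v) (lin (seqι G n) g) = lin (v n) g := fun n g => by
    rw [← LinearMap.comp_apply, ← lin_comp, seqι_desc]
  have hV : ∀ x, lin (seqDesc v) (lin (idSubShift t) x) = lin (idSubShift t ≫ seqDesc v) x :=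
    fun x => rfl
  refine ⟨w, (isQuasiIso_iff w).2 ⟨?_, fun m hm => ?_⟩⟩
  · rintro ⟨y, x⟩ hyx ⟨m, hm⟩
    rw [cone_d, Prod.mk_eq_zero, sub_eq_zero] at hyx
    obtain ⟨hy, hx⟩ := hyx
    replace hx : (seqSum G).d x = 0 := hx
    -- The cocycle condition says that `id - shift` sends `sign x` to a boundary, so `sign x` is
    -- itself a boundary. Subtracting a boundary of the cone then reduces to the case where the
    -- second component is zero.
    obtain ⟨x', hx'⟩ := idSubShift_injective t ((seqSum G).sign x) ⟨y, hy⟩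
    have hy' : (seqSum G).d (y - lin (idSubShift t) x') = 0 := by
      rw [map_sub, ← lin_d, hx', hy, sub_self]
    obtain ⟨n, g, x₁, hg, hx₁, e⟩ := exists_eq_seqι_add t _ hy'
    obtain ⟨m₁, hm₁⟩ := hδ.isGhost x₁ hx₁
    have e₂ : ((y, x) : (cone (idSubShift t)).carrier) =
        (lin (seqι G n) g + lin (idSubShift t) x₁, 0) +
          (cone (idSubShift t)).d (0, -(seqSum G).sign x') := by
      rw [cone_d_neg_sign, hx', sign_sign, ← e]
      simp
    -- The class of `g` dies in `M`, because the other terms of `(y, x)` map to boundaries; it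
    -- therefore already dies at stage `n + 1`.
    obtain ⟨b, hb⟩ := hker n g hg ⟨m - m₁ - lin w (0, -(seqSum G).sign x'), by
      rw [map_sub, map_sub, ← lin_d w, hm, hm₁, e₂, map_add, hw', map_add, hv', hV]
      abel⟩
    -- The three terms bound the image of `t n g` at stage `n + 1`, then `id - shift` applied to `g`
    -- at stage `n` and to `x₁`, then the boundary split off above. The first two add up by
    -- `seqι_eq`.
    refine ⟨(lin (seqι G (n + 1)) b, 0) + (0, -(seqSum G).sign (lin (seqι G n) g + x₁)) +
      (0, -(seqSum G).sign x'), ?_⟩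
    have e₃ : (seqSum G).d (lin (seqι G n) g + x₁) = 0 := by
      rw [map_add, hx₁, d_seqι hg, add_zero]
    rw [map_add, map_add, e₂]
    congr 1
    rw [cone_d_neg_sign, e₃, map_zero, cone_d, ← lin_d, hb, map_add (lin (idSubShift t))]
    conv_rhs => rw [seqι_eq t n g]
    refine Prod.ext ?_ ?_
    · change _ - lin (idSubShift t) ((seqSum G).sign 0) + _ = _
      rw [map_zero, map_zero, sub_zero, add_assoc]
    · change (seqSum G).d 0 + 0 = 0
      rw [map_zero, add_zero]
  · obtain ⟨n, g, hg, m', hm'⟩ := hsurj m hm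
    refine ⟨(lin (seqι G n) g, 0), ?_, m', ?_⟩
    · rw [cone_d, d_seqι hg]; simp
    · rw [hw', hv', hm']

/-- If the transition maps vanish on cohomology, then `idSubShift t` is a quasi-isomorphism. -/
lemma isQuasiIso_idSubShift (ht : ∀ n, IsGhost (t n)) : IsQuasiIso (idSubShift t) := by
  -- A cocycle `y` serves as its own preimage, since `y - (id - shift) y` is the shift of `y`, which
  -- is a boundary when the transition maps are ghosts.
  refine (isQuasiIso_iff _).2 ⟨fun x _ => idSubShift_injective t x, fun y hy => ⟨y, hy, ?_⟩⟩
  obtain ⟨s, hs⟩ := seq_eq_sum y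
  have hπ : ∀ n, (G n).d (lin (seqπ G n) y) = 0 := fun n => by rw [← lin_d, hy, map_zero]
  choose z hz using fun n => ht n _ (hπ n)
  refine ⟨∑ n ∈ s, lin (seqι G (n + 1)) (z n), ?_⟩
  have : y - lin (idSubShift t) y = ∑ n ∈ s, (lin (seqι G n) (lin (seqπ G n) y) -
      lin (idSubShift t) (lin (seqι G n) (lin (seqπ G n) y))) := by
    rw [Finset.sum_sub_distrib, ← map_sum, ← hs]
  rw [this, map_sum]
  refine Finset.sum_congr rfl fun n _ => ?_
  rw [← lin_d, hz, eq_comm, sub_eq_iff_eq_add]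
  exact seqι_eq t n _

lemma isKProjective_seqSum (hG : ∀ n, (G n).IsKProjective) : (seqSum G).IsKProjective :=
  isKProjective_coprod fun n => hG n.down

end Telescope

/-! ### Towers whose cones have ghost transition maps -/

section Tower

variable {G' : DGModule A} {ι : G ⟶ G'} {f : G ⟶ M} {f' : G' ⟶ M}

/-- The morphism of mapping cones induced by a factorization. -/
def coneMap (h : ι ≫ f' = f) : cone f ⟶ cone f' :=
  (⟨LinearMap.prodMap LinearMap.id (lin (M := G) (N := G') ι),
    fun _ _ h => ⟨h.1, lin_mem ι h.2⟩, fun x => by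
    obtain ⟨m, g⟩ := x
    rw [cone_d]
    change (M.d m - lin f (G.sign g), lin ι (G.d g)) = (cone f').d (m, lin ι g)
    rw [cone_d, sign_lin, ← lin_d, ← h]
    rfl⟩ : Hom (cone f) (cone f'))

lemma coneMap_apply (h : ι ≫ f' = f) (x : M.carrier × G.carrier) :
    lin (coneMap h) x = (x.1, lin ι x.2) := rfl

lemma coneInl_coneMap (h : ι ≫ f' = f) : coneInl f ≫ coneMap h = coneInl f' :=
  hom_ext (LinearMap.ext fun m => by
    change ((m, lin ι 0) : M.carrier × G'.carrier) = (m, 0)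
    rw [map_zero])

/-- Attaching to `G` generators which kill the cohomology of the cone of `f`. -/
lemma exists_attach (f : G ⟶ M) (π : P ⟶ cone f) (hπ : CohomologySurjective π) :
    ∃ f' : twist (π ≫ twistSnd _) ⟶ M, ∃ h : twistInl (π ≫ twistSnd _) ≫ f' = f,
      IsGhost (coneMap h) := by
  let φ : P ⟶ shift 1 G := π ≫ twistSnd _
  have hφ : ∀ p, lin φ p = (lin π p).2 := fun _ => rfl
  have h₁ : ∀ p, lin f (lin φ (P.sign p)) = -lin f (G.sign (lin π p).2) := fun p => by
    rw [← sign_lin, sign_shift_one]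
    exact map_neg (lin f) _
  have h₂ : ∀ p, (lin π (P.d p)).1 = M.d (lin π p).1 - lin f (G.sign (lin π p).2) := fun p =>
    congrArg Prod.fst ((lin_d π p).trans (cone_d f _ _))
  -- For `p` in `P`, the second component of `π p` prescribes how `p` is attached to `G`, and minus
  -- the first component prescribes its image in `M`.
  let f' : twist φ ⟶ M := (⟨(lin f).coprod (-(LinearMap.fst _ _ _).comp (lin π)),
    fun i x hx => add_mem (lin_mem f hx.1) (neg_mem (lin_mem π hx.2).1), fun ⟨g, p⟩ => by
      change lin f (G.d g + lin φ (P.sign p)) + -(lin π (P.d p)).1 =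
        M.d (lin f g + -(lin π p).1)
      rw [map_add, h₁, h₂, map_add, map_neg, ← lin_d]
      abel⟩ : Hom (twist φ) M)
  have hf' : ∀ x, lin f' x = lin f x.1 + -(lin π x.2).1 := fun _ => rfl
  have h : twistInl φ ≫ f' = f := hom_ext (LinearMap.ext fun g => by
    change lin f g + -(lin π 0).1 = lin f g
    rw [map_zero]; simp)
  refine ⟨f', h, fun x hx => ?_⟩
  obtain ⟨p, hp, b, hb⟩ := hπ x hx
  -- In the new cone the attached generators bound the image of `π p`, and these classes exhaust the
  -- cohomology of the old cone.
  have e : (cone f').d (0, -(twist φ).sign (0, -p)) = lin (coneMap h) (lin π p) := by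
    rw [cone_d_neg_sign, hf', twist_d, map_neg, map_neg, map_neg P.d, hp, twist_sign, coneMap_apply]
    refine Prod.ext ?_ (Prod.ext ?_ ?_)
    · simp
    · change G.sign (G.d 0 + lin φ (-P.sign p)) = (lin π p).2
      rw [map_zero, zero_add, map_neg, ← sign_lin, sign_shift_one, neg_neg, sign_sign, hφ]
    · change P.sign (-0) = 0
      simp
  refine ⟨lin (coneMap h) b + (0, -(twist φ).sign (0, -p)), ?_⟩
  rw [map_add, ← lin_d, hb, e, map_sub, sub_add_cancel]

/-- The existence of towers over `M` with transition maps vanishing on the cohomology of the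
mapping cones, with all stages satisfying a given property. -/
theorem exists_tower (R : ∀ G : DGModule A, (G ⟶ M) → Prop) {G₀ : DGModule A} (f₀ : G₀ ⟶ M)
    (h₀ : R G₀ f₀)
    (hR : ∀ (G : DGModule A) (f : G ⟶ M), R G f → ∃ (P : DGModule A) (π : P ⟶ cone f),
      CohomologySurjective π ∧ ∀ f', R (twist (π ≫ twistSnd _)) f') :
    ∃ (G : ℕ → DGModule A) (f : ∀ n, G n ⟶ M) (ι : ∀ n, G n ⟶ G (n + 1))
      (h : ∀ n, ι n ≫ f (n + 1) = f n), (∀ n, IsGhost (coneMap (h n))) ∧ ∀ n, R (G n) (f n) := by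
  let S := {x : Σ G : DGModule A, G ⟶ M // R x.1 x.2}
  have step : ∀ x : S, ∃ (y : S) (ι : x.1.1 ⟶ y.1.1) (h : ι ≫ y.1.2 = x.1.2),
      IsGhost (coneMap h) := by
    rintro ⟨⟨G, f⟩, hx⟩
    obtain ⟨P, π, hπ, hR'⟩ := hR G f hx
    obtain ⟨f', h, hg⟩ := exists_attach f π hπ
    exact ⟨⟨⟨_, f'⟩, hR' f'⟩, _, h, hg⟩
  choose next ι h hg using step
  let x : ℕ → S := fun n => Nat.rec ⟨⟨G₀, f₀⟩, h₀⟩ (fun _ y => next y) n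
  exact ⟨fun n => (x n).1.1, fun n => (x n).1.2, fun n => ι (x n), fun n => h (x n),
    fun n => hg (x n), fun n => (x n).2⟩

end Tower

end DGModule

namespace DGModule
variable {k : Type v} [Field k] {A : DGAlgebra.{v, u} k} {M N P G : DGModule A}

/-! ### DG free modules and homogeneous cocycles -/

section Free

variable {Y : Type u} (deg : Y → ℤ)

/-- The DG free module on cocycles of the given degrees. -/
abbrev free : DGModule A := coprod fun y => shift (-deg y) (self A)

/-- The morphism from a shift of `A` defined by a homogeneous cocycle. -/
def ofCocycle {i : ℤ} {c : M.carrier} (hc : c ∈ M.gr i) (hd : M.d c = 0) :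
    shift (-i) (self A) ⟶ M :=
  (⟨LinearMap.toSpanSingleton A.carrier M.carrier c, fun j a ha => by
    have := M.smul_mem (j + -i) i a c ha hc
    rwa [neg_add_cancel_right] at this, fun a => by
    change A.d a • c = M.d (a • c)
    rw [M.d_smul_of_d_eq_zero _ _ hd]⟩ : Hom (shift (-i) (self A)) M)

lemma ofCocycle_apply {i : ℤ} {c : M.carrier} (hc : c ∈ M.gr i) (hd : M.d c = 0)
    (a : A.carrier) : lin (ofCocycle hc hd) a = a • c := rfl

variable (M) in
/-- Homogeneous cocycles of a DG module. -/
abbrev HomogeneousCocycle : Type u := Σ i : ℤ, {c : M.carrier // c ∈ M.gr i ∧ M.d c = 0}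

/-- The cohomology class of a homogeneous cocycle. -/
def HomogeneousCocycle.cls (c : HomogeneousCocycle M) : M.Cohomology :=
  Submodule.Quotient.mk ⟨c.2.1, c.2.2.2⟩

-- The components of a cocycle are cocycles. Hence generators of cohomology may be taken
-- homogeneous, as is needed to map shifts of `A` onto them.
variable (M) in
lemma span_range_cls :
    Submodule.span A.cocycles (Set.range (HomogeneousCocycle.cls (M := M))) = ⊤ := by
  refine eq_top_iff.2 fun x _ => ?_
  obtain ⟨⟨m, hm⟩, rfl⟩ := Submodule.Quotient.mk_surjective _ x
  obtain ⟨s, hs⟩ := sum_component M m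
  have hd : ∀ i, M.d (M.component i m) = 0 := fun i => by
    rw [← component_d, show M.d m = 0 from hm, map_zero]
  have e : (⟨m, hm⟩ : M.cocycles) = ∑ i ∈ s, ⟨M.component i m, hd i⟩ :=
    Subtype.ext (by rw [AddSubmonoidClass.coe_finsetSum]; exact hs)
  rw [e, ← Submodule.mkQ_apply, map_sum]
  exact sum_mem fun i _ => Submodule.subset_span ⟨⟨i, _, component_mem i m, hd i⟩, rfl⟩

/-- The morphism from a DG free module defined by a family of homogeneous cocycles. -/
def freeDesc (c : Y → HomogeneousCocycle M) : free (A := A) (fun y => (c y).1) ⟶ M :=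
  coprodDesc fun y => ofCocycle (c y).2.2.1 (c y).2.2.2

lemma cohomologySurjective_freeDesc (c : Y → HomogeneousCocycle M)
    (hc : Submodule.span A.cocycles (Set.range fun y => (c y).cls) = ⊤) :
    CohomologySurjective (freeDesc c) := by
  rw [← surjective_cohomologyMap_iff, ← LinearMap.range_eq_top, eq_top_iff, ← hc,
    Submodule.span_le]
  rintro _ ⟨y, rfl⟩
  have h1 : (free (A := A) fun y => (c y).1).d
      (lin (coprodι (fun y => shift (-(c y).1) (self A)) y) (1 : A.carrier)) = 0 := by
    rw [← lin_d]
    exact (congrArg _ A.d_one).trans (map_zero _)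
  refine ⟨Submodule.Quotient.mk ⟨_, h1⟩, ?_⟩
  have : lin (freeDesc c) (lin (coprodι (fun y => shift (-(c y).1) (self A)) y) (1 : A.carrier)) =
      (c y).2.1 := by
    rw [freeDesc, coprodDesc_ι_apply, ofCocycle_apply, one_smul]
  exact congrArg Submodule.Quotient.mk (Subtype.ext this)

lemma isKProjective_free : (free (A := A) deg).IsKProjective :=
  isKProjective_coprod fun _ => (isKProjective_self A).shift _

end Free

/-! ### K-projective resolutions -/

section Resolution

/-- A tower over `M` whose mapping cones have vanishing transition maps on cohomology, and all of
whose stages are K-projective, gives a K-projective resolution. -/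
lemma exists_quasiIso_of_tower {G : ℕ → DGModule A} {f : ∀ n, G n ⟶ M} {ι : ∀ n, G n ⟶ G (n + 1)}
    (h : ∀ n, ι n ≫ f (n + 1) = f n) (hg : ∀ n, IsGhost (coneMap (h n))) :
    ∃ w : cone (idSubShift ι) ⟶ M, IsQuasiIso w := by
  refine exists_quasiIso_telescope ι f (fun n => ?_) (fun m hm => ?_) (fun n g hg' hm => ?_)
  · rw [h, sub_self]
    exact nullHomotopic_zero
  -- The cocycle `(m, 0)` of the first cone bounds in the next one, which exhibits `m` as
  -- cohomologous to an element coming from stage `1`.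
  · obtain ⟨⟨m', g⟩, hb⟩ := hg 0 (m, 0) (by rw [cone_d, hm, map_zero, map_zero, map_zero]; simp)
    rw [cone_d, coneMap_apply, map_zero] at hb
    have h₁ := congrArg Prod.fst hb
    have h₂ : (G (0 + 1)).d g = 0 := congrArg Prod.snd hb
    refine ⟨1, -(G 1).sign g, by rw [map_neg, d_sign, h₂]; simp, m', ?_⟩
    rw [map_neg, sub_neg_eq_add, ← sub_eq_iff_eq_add]
    exact h₁
  · obtain ⟨m, hm⟩ := hm
    -- A cocycle `g` whose image bounds `m` gives a cocycle of the cone. Its bounding element at the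
    -- next stage contains, up to sign, a primitive of `ι g`.
    obtain ⟨⟨m', g'⟩, hb⟩ := hg n (m, (G n).sign g) (by
      rw [cone_d, sign_sign, d_sign, hg', hm]; simp)
    have h₁ : (G (n + 1)).d g' = lin (ι n) ((G n).sign g) := congrArg Prod.snd hb
    exact ⟨-(G (n + 1)).sign g', by rw [map_neg, d_sign, h₁, sign_lin, sign_sign, neg_neg]⟩

variable (M) in
/-- Every DG module has a K-projective resolution. -/
theorem exists_kProjective_resolution :
    ∃ (P : DGModule A) (u : P ⟶ M), P.IsKProjective ∧ IsQuasiIso u := by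
  obtain ⟨G, f, ι, h, hg, hR⟩ := exists_tower (M := M) (fun G _ => G.IsKProjective)
    (0 : self A ⟶ M) (isKProjective_self A) fun G f hG =>
      ⟨_, freeDesc (fun y : HomogeneousCocycle (cone f) => y),
        cohomologySurjective_freeDesc _ (span_range_cls _),
        fun _ => isKProjective_twist _ hG (isKProjective_free _)⟩
  obtain ⟨w, hw⟩ := exists_quasiIso_of_tower h hg
  exact ⟨_, w, isKProjective_cone _ (isKProjective_seqSum hR) (isKProjective_seqSum hR), hw⟩

end Resolution

/-! ### Direct sums are coproducts in the derived category -/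

section Coproducts

variable {J : Type u} (N : J → DGModule A)

lemma isQuasiIso_coprodDesc {P N : J → DGModule A} (u : ∀ j, P j ⟶ N j)
    (hu : ∀ j, IsQuasiIso (u j)) : IsQuasiIso (coprodDesc fun j => u j ≫ coprodι N j) := by
  set U := coprodDesc fun j => u j ≫ coprodι N j
  have hU : ∀ j, U ≫ coprodπ N j = coprodπ P j ≫ u j := by
    intro j
    refine coprod_hom_ext fun i => ?_
    rw [← Category.assoc, coprodι_desc, Category.assoc, ← Category.assoc _ (coprodπ P j)]
    by_cases h : i = j
    · subst h
      refine hom_ext (LinearMap.ext fun x => ?_)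
      change lin (coprodπ N i) (lin (coprodι N i) (lin (u i) x)) =
        lin (u i) (lin (coprodπ P i) (lin (coprodι P i) x))
      rw [coprodπ_ι, coprodπ_ι]
    · refine hom_ext (LinearMap.ext fun x => ?_)
      simp [coprodπ_ι_ne h]
  have hU' : ∀ j x, lin (coprodπ N j) (lin U x) = lin (u j) (lin (coprodπ P j) x) :=
    fun j x => congrArg (fun f => lin f x) (hU j)
  have hUι : ∀ j x, lin U (lin (coprodι P j) x) = lin (coprodι N j) (lin (u j) x) :=
    fun j x => coprodDesc_ι_apply _ j x
  replace hu := fun j => (isQuasiIso_iff _).1 (hu j)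
  refine (isQuasiIso_iff _).2 ⟨fun x hx ⟨y, hy⟩ => ?_, fun y hy => ?_⟩
  · have key : ∀ j, ∃ z, (P j).d z = lin (coprodπ P j) x := fun j =>
      (hu j).1 _ (by rw [← lin_d, hx, map_zero]) ⟨lin (coprodπ N j) y, by rw [← lin_d, hy, hU']⟩
    choose z hz using key
    obtain ⟨s, hs⟩ := eq_sum_coprodι x
    refine ⟨∑ j ∈ s, lin (coprodι P j) (z j), ?_⟩
    rw [map_sum]
    refine Eq.trans (Finset.sum_congr rfl fun j _ => ?_) hs.symm
    rw [← lin_d, hz]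
  · have key : ∀ j, _ := fun j => (hu j).2 (lin (coprodπ N j) y) (by rw [← lin_d, hy, map_zero])
    choose z hz z' hz' using key
    obtain ⟨s, hs⟩ := eq_sum_coprodι y
    refine ⟨∑ j ∈ s, lin (coprodι P j) (z j), ?_, ∑ j ∈ s, lin (coprodι N j) (z' j), ?_⟩
    · rw [map_sum]
      exact Finset.sum_eq_zero fun j _ => by rw [← lin_d, hz, map_zero]
    · conv_rhs => enter [1]; rw [hs]
      rw [map_sum, map_sum, ← Finset.sum_sub_distrib]
      refine Finset.sum_congr rfl fun j _ => ?_
      rw [← lin_d, hz', hUι, map_sub]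

/-- The direct sum of DG modules, as a cofan in the derived category. -/
abbrev derivedCofan : Cofan fun j => (toDerivedCat A).obj (N j) :=
  Cofan.mk ((toDerivedCat A).obj (coprod N)) fun j => (toDerivedCat A).map (coprodι N j)

/-- Replacing each `N j` by a K-projective resolution turns both morphisms into honest ones, and
null-homotopies of their difference can be chosen one summand at a time. -/
lemma derived_coprod_hom_ext {X : DGModule A}
    {φ ψ : (toDerivedCat A).obj (coprod N) ⟶ (toDerivedCat A).obj X}
    (h : ∀ j, (toDerivedCat A).map (coprodι N j) ≫ φ = (toDerivedCat A).map (coprodι N j) ≫ ψ) :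
    φ = ψ := by
  choose P u hP hu using fun j => exists_kProjective_resolution (N j)
  have := isIso_map (isQuasiIso_coprodDesc u hu)
  rw [← cancel_epi ((toDerivedCat A).map (coprodDesc fun j => u j ≫ coprodι N j))]
  obtain ⟨f, hf⟩ := (isKProjective_coprod hP).exists_map_eq
    ((toDerivedCat A).map (coprodDesc fun j => u j ≫ coprodι N j) ≫ φ)
  obtain ⟨g, hg⟩ := (isKProjective_coprod hP).exists_map_eq
    ((toDerivedCat A).map (coprodDesc fun j => u j ≫ coprodι N j) ≫ ψ)
  rw [← hf, ← hg]
  refine NullHomotopic.map_eq (nullHomotopic_coprod fun j => (hP j).nullHomotopic_of_map_eq_zero ?_)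
  rw [Functor.map_comp, Functor.map_sub, Preadditive.comp_sub, hf, hg, sub_eq_zero,
    ← Functor.map_comp_assoc, ← Functor.map_comp_assoc, coprodι_desc, Functor.map_comp,
    Category.assoc, Category.assoc, h]

lemma derived_coprod_exists_desc {X : DGModule A}
    (φ : ∀ j, (toDerivedCat A).obj (N j) ⟶ (toDerivedCat A).obj X) :
    ∃ ψ : (toDerivedCat A).obj (coprod N) ⟶ (toDerivedCat A).obj X,
      ∀ j, (toDerivedCat A).map (coprodι N j) ≫ ψ = φ j := by
  choose P u hP hu using fun j => exists_kProjective_resolution (N j)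
  have := isIso_map (isQuasiIso_coprodDesc u hu)
  choose f hf using fun j => (hP j).exists_map_eq ((toDerivedCat A).map (u j) ≫ φ j)
  refine ⟨inv ((toDerivedCat A).map (coprodDesc fun j => u j ≫ coprodι N j)) ≫
    (toDerivedCat A).map (coprodDesc f), fun j => ?_⟩
  have := isIso_map (hu j)
  rw [← cancel_epi ((toDerivedCat A).map (u j)), ← hf, ← Functor.map_comp_assoc,
    ← coprodι_desc (fun j => u j ≫ coprodι N j) j, Functor.map_comp_assoc, IsIso.hom_inv_id_assoc,
    ← Functor.map_comp, coprodι_desc]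

/-- Direct sums of DG modules are coproducts in the derived category. -/
def isColimitDerivedCofan : IsColimit (derivedCofan N) :=
  Cofan.IsColimit.mk _
    (fun s => (derived_coprod_exists_desc (X := LocalizationAdd.pt _ s.pt) N s.inj).choose)
    (fun s j => (derived_coprod_exists_desc (X := LocalizationAdd.pt _ s.pt) N s.inj).choose_spec j)
    (fun s _ hm => derived_coprod_hom_ext (X := LocalizationAdd.pt _ s.pt) N fun j =>
      (hm j).trans ((derived_coprod_exists_desc (X := LocalizationAdd.pt _ s.pt) N
        s.inj).choose_spec j).symm)

end Coproducts

end DGModule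

namespace DGModule
variable {k : Type v} [Field k] {A : DGAlgebra.{v, u} k} {M N P G : DGModule A}

/-! ### Compactness as factorization through finite subsums -/

section Compact

variable (M) in
/-- The morphisms in the derived category from `M` to a direct sum which factor through a finite
subsum. -/
def finitelySupported {J : Type u} (N : J → DGModule A) :
    AddSubgroup ((toDerivedCat A).obj M ⟶ (toDerivedCat A).obj (coprod N)) :=
  ⨆ j, (Preadditive.rightComp ((toDerivedCat A).obj M)
    ((toDerivedCat A).map (coprodι N j))).range

lemma comp_mem_finitelySupported {J : Type u} {N : J → DGModule A} (j : J)
    (φ : (toDerivedCat A).obj M ⟶ (toDerivedCat A).obj (N j)) :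
    φ ≫ (toDerivedCat A).map (coprodι N j) ∈ finitelySupported M N :=
  AddSubgroup.mem_iSup_of_mem j ⟨φ, rfl⟩

lemma finitelySupported_induction {J : Type u} {N : J → DGModule A}
    {p : ((toDerivedCat A).obj M ⟶ (toDerivedCat A).obj (coprod N)) → Prop} {φ}
    (hφ : φ ∈ finitelySupported M N) (zero : p 0)
    (of : ∀ j ψ, p (ψ ≫ (toDerivedCat A).map (coprodι N j)))
    (add : ∀ φ ψ, p φ → p ψ → p (φ + ψ)) : p φ :=
  AddSubgroup.iSup_induction (C := p) _ hφ (by rintro j _ ⟨ψ, rfl⟩; exact of j ψ) zero add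

lemma map_coprodι_π {J : Type u} (N : J → DGModule A) (j : J) :
    (toDerivedCat A).map (coprodι N j) ≫ (toDerivedCat A).map (coprodπ N j) = 𝟙 _ := by
  rw [← Functor.map_comp, ← CategoryTheory.Functor.map_id]
  congr 1
  exact hom_ext (LinearMap.ext fun x => coprodπ_ι j x)

lemma map_coprodι_π_ne {J : Type u} (N : J → DGModule A) {i j : J} (h : i ≠ j) :
    (toDerivedCat A).map (coprodι N i) ≫ (toDerivedCat A).map (coprodπ N j) = 0 := by
  rw [← Functor.map_comp, ← Functor.map_zero]
  congr 1
  exact hom_ext (LinearMap.ext fun x => coprodπ_ι_ne h x)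

lemma finite_of_mem_finitelySupported {J : Type u} {N : J → DGModule A}
    {φ : (toDerivedCat A).obj M ⟶ (toDerivedCat A).obj (coprod N)}
    (hφ : φ ∈ finitelySupported M N) :
    {j | φ ≫ (toDerivedCat A).map (coprodπ N j) ≠ 0}.Finite := by
  refine finitelySupported_induction
    (p := fun φ => {j | φ ≫ (toDerivedCat A).map (coprodπ N j) ≠ 0}.Finite) hφ (by simp)
    (fun i ψ => ?_) (fun φ ψ hφ hψ => ?_)
  · refine (Set.finite_singleton i).subset fun j hj => ?_
    by_contra h
    exact hj (by rw [Category.assoc, map_coprodι_π_ne N (Ne.symm h), comp_zero])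
  · refine (hφ.union hψ).subset fun j hj => ?_
    by_contra h
    simp only [Set.mem_union, Set.mem_ofPred_eq, not_or, not_not] at h
    exact hj (by rw [Preadditive.add_comp, h.1, h.2, add_zero])

lemma IsCompact.mem_finitelySupported (hM : M.IsCompact) {J : Type u} (N : J → DGModule A)
    (φ : (toDerivedCat A).obj M ⟶ (toDerivedCat A).obj (coprod N)) :
    φ ∈ finitelySupported M N := by
  have := hM J
  let F : DerivedCat A ⥤ AddCommGrpCat := preadditiveCoyoneda.obj (op ((toDerivedCat A).obj M))
  have hc : IsColimit (F.mapCocone (derivedCofan N)) :=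
    isColimitOfPreserves _ (isColimitDerivedCofan N)
  let q : F.obj ((toDerivedCat A).obj (coprod N)) ⟶
      AddCommGrpCat.of (((toDerivedCat A).obj M ⟶ (toDerivedCat A).obj (coprod N)) ⧸
        finitelySupported M N) :=
    AddCommGrpCat.ofHom (QuotientAddGroup.mk' (finitelySupported M N))
  -- Compactness presents morphisms into the direct sum as a colimit of abelian groups, so the
  -- quotient map `q`, which kills every summand, is zero.
  have hq : q = 0 := hc.hom_ext fun j => by
    refine AddCommGrpCat.hom_ext (AddMonoidHom.ext fun ψ => ?_)
    exact (QuotientAddGroup.eq_zero_iff _).2 (comp_mem_finitelySupported j.as ψ)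
  exact (QuotientAddGroup.eq_zero_iff _).1 (ConcreteCategory.congr_hom hq φ)

-- The comparison map `Θ` from the direct sum of the groups of morphisms is always injective, by the
-- projections, and the hypothesis makes it surjective. The image cocone is thus the direct sum of
-- abelian groups, hence a colimit.
open scoped Classical in
lemma isCompact_of_mem_finitelySupported
    (h : ∀ (J : Type u) (N : J → DGModule A)
      (φ : (toDerivedCat A).obj M ⟶ (toDerivedCat A).obj (coprod N)),
        φ ∈ finitelySupported M N) : M.IsCompact := by
  intro J
  refine ⟨fun {K} => ?_⟩
  let F : DerivedCat A ⥤ AddCommGrpCat := preadditiveCoyoneda.obj (op ((toDerivedCat A).obj M))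
  change PreservesColimit K F
  let N : J → DGModule A := fun j => LocalizationAdd.pt _ (K.obj ⟨j⟩)
  let e : Discrete.functor (fun j => (toDerivedCat A).obj (N j)) ≅ K :=
    Discrete.natIsoFunctor.symm
  suffices PreservesColimit (Discrete.functor fun j => (toDerivedCat A).obj (N j)) F from
    preservesColimit_of_iso_diagram F e
  let Θ : (DirectSum J fun j => ((toDerivedCat A).obj M ⟶ (toDerivedCat A).obj (N j))) →+
      ((toDerivedCat A).obj M ⟶ (toDerivedCat A).obj (coprod N)) :=
    DirectSum.toAddMonoid fun j => Preadditive.rightComp _ ((toDerivedCat A).map (coprodι N j))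
  have hΘ : ∀ j ψ, Θ (DirectSum.of _ j ψ) = ψ ≫ (toDerivedCat A).map (coprodι N j) :=
    fun j ψ => DirectSum.toAddMonoid_of _ _ _
  have hπ : ∀ x j, Θ x ≫ (toDerivedCat A).map (coprodπ N j) = x j := by
    intro x j
    induction x using DirectSum.induction_on with
    | zero => rw [map_zero, zero_comp]; rfl
    | of i ψ =>
      rw [hΘ, Category.assoc]
      by_cases hij : i = j
      · subst hij
        rw [map_coprodι_π, Category.comp_id, DirectSum.of_eq_same]
      · rw [map_coprodι_π_ne N hij, comp_zero, DirectSum.of_eq_of_ne _ _ _ (Ne.symm hij)]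
    | add x y hx hy => rw [map_add, Preadditive.add_comp, hx, hy]; rfl
  have hb : Function.Bijective Θ := by
    refine ⟨fun x y hxy => DFinsupp.ext fun j => ?_, fun φ => ?_⟩
    · rw [← hπ, ← hπ, hxy]
    · refine finitelySupported_induction (p := fun φ => ∃ x, Θ x = φ) (h J N φ) ⟨0, map_zero _⟩
        (fun j ψ => ⟨_, hΘ j ψ⟩) ?_
      rintro _ _ ⟨x, rfl⟩ ⟨y, rfl⟩
      exact ⟨x + y, map_add _ _ _⟩
  let E := AddEquiv.ofBijective Θ hb
  have hE : ∀ j ψ, E.symm (ψ ≫ (toDerivedCat A).map (coprodι N j)) = DirectSum.of _ j ψ :=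
    fun j ψ => (AddEquiv.symm_apply_eq E).2 (hΘ j ψ).symm
  let leg : ∀ (s : Cocone ((Discrete.functor fun j => (toDerivedCat A).obj (N j)) ⋙ F)) (j : J),
      ((toDerivedCat A).obj M ⟶ (toDerivedCat A).obj (N j)) →+ s.pt :=
    fun s j => (s.ι.app ⟨j⟩).hom
  refine preservesColimit_of_preserves_colimit_cocone (isColimitDerivedCofan N)
    { desc := fun s => AddCommGrpCat.ofHom
        ((DirectSum.toAddMonoid (leg s)).comp E.symm.toAddMonoidHom)
      fac := fun s j => ?_
      uniq := fun s m hm => ?_ }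
  · refine AddCommGrpCat.hom_ext (AddMonoidHom.ext fun ψ => ?_)
    have : ∀ i ψ, DirectSum.toAddMonoid (leg s)
        (E.symm (ψ ≫ (toDerivedCat A).map (coprodι N i))) = leg s i ψ := fun i ψ => by
      rw [hE, DirectSum.toAddMonoid_of]
    exact this j.as ψ
  · refine AddCommGrpCat.hom_ext (AddMonoidHom.ext fun φ => ?_)
    obtain ⟨x, rfl⟩ := E.surjective φ
    let m' : ((toDerivedCat A).obj M ⟶ (toDerivedCat A).obj (coprod N)) →+ s.pt := m.hom
    have key : m'.comp Θ = DirectSum.toAddMonoid (leg s) := DirectSum.addHom_ext fun j ψ => by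
      rw [AddMonoidHom.comp_apply, hΘ, DirectSum.toAddMonoid_of]
      exact ConcreteCategory.congr_hom (hm ⟨j⟩) ψ
    have : m' (Θ x) = DirectSum.toAddMonoid (leg s) (E.symm (E x)) := by
      rw [E.symm_apply_apply, ← key]; rfl
    exact this

/-- A retract in the derived category of a compact DG module is compact. -/
lemma isCompact_of_retract
    (h : ∀ (J : Type u) (N : J → DGModule A)
      (φ : (toDerivedCat A).obj G ⟶ (toDerivedCat A).obj (coprod N)),
        φ ∈ finitelySupported G N)
    (i : (toDerivedCat A).obj M ⟶ (toDerivedCat A).obj G)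
    (p : (toDerivedCat A).obj G ⟶ (toDerivedCat A).obj M) (hip : i ≫ p = 𝟙 _) : M.IsCompact := by
  refine isCompact_of_mem_finitelySupported fun J N φ => ?_
  have key : ∀ ψ ∈ finitelySupported G N, i ≫ ψ ∈ finitelySupported M N := by
    intro ψ hψ
    refine finitelySupported_induction (p := fun ψ => i ≫ ψ ∈ finitelySupported M N) hψ ?_
      (fun j ψ => ?_) (fun φ ψ hφ hψ => ?_)
    · rw [comp_zero]; exact zero_mem _
    · rw [← Category.assoc]; exact comp_mem_finitelySupported j _
    · rw [Preadditive.comp_add]; exact add_mem hφ hψ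
  have := key _ (h J N (p ≫ φ))
  rwa [← Category.assoc, hip, Category.id_comp] at this

lemma lin_sum_apply {ι : Type*} (s : Finset ι) (f : ι → (M ⟶ N)) (x : M.carrier) :
    lin (∑ i ∈ s, f i) x = ∑ i ∈ s, lin (f i) x := by
  classical
  induction s using Finset.induction_on with
  | empty => simp
  | insert i s hi h => rw [Finset.sum_insert hi, Finset.sum_insert hi, lin_add, ← h]; rfl

/-- A morphism out of `G` is represented by a linear map, and the images of finitely many generators
involve only finitely many summands. -/
lemma finitelySupported_of_finite (hG : G.IsKProjective) [Module.Finite A.carrier G.carrier]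
    {J : Type u} (N : J → DGModule A)
    (φ : (toDerivedCat A).obj G ⟶ (toDerivedCat A).obj (coprod N)) :
    φ ∈ finitelySupported G N := by
  classical
  obtain ⟨f, rfl⟩ := hG.exists_map_eq φ
  obtain ⟨S, hS⟩ := Module.Finite.fg_top (R := A.carrier) (M := G.carrier)
  choose s hs using fun x : G.carrier => eq_sum_coprodι (lin f x)
  have key : f = ∑ j ∈ S.biUnion s, (f ≫ coprodπ N j) ≫ coprodι N j := by
    have hle : ∀ x, x ∈ LinearMap.eqLocus (lin f)
        (lin (∑ j ∈ S.biUnion s, (f ≫ coprodπ N j) ≫ coprodι N j)) := by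
      intro x
      have hx : x ∈ Submodule.span A.carrier (S : Set G.carrier) := hS ▸ Submodule.mem_top
      refine Submodule.span_le.2 (fun y hy => ?_) hx
      change lin f y = _
      rw [lin_sum_apply]
      conv_lhs => rw [hs y]
      refine Finset.sum_subset (Finset.subset_biUnion_of_mem s hy) fun j _ hj => ?_
      have := congrArg (lin (coprodπ N j)) (hs y)
      rw [map_sum, Finset.sum_eq_zero (fun i hi => coprodπ_ι_ne (by rintro rfl; exact hj hi) _)]
        at this
      rw [this, map_zero]
    exact hom_ext (LinearMap.ext hle)
  rw [key, Functor.map_sum]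
  exact sum_mem fun j _ => by
    rw [Functor.map_comp]
    exact comp_mem_finitelySupported j _

end Compact

end DGModule

namespace DGModule
variable {k : Type v} [Field k] {A : DGAlgebra.{v, u} k} {M N P G F : DGModule A}

/-! ### Working with DG free quotients -/

section FreeQuotient

/-- Independence and generation are stated inside `F`, modulo `S`, so that filtrations can be
handled without elements of quotient modules. -/
lemma isDGFreeQuotient_iff {S S' : Submodule A.carrier F.carrier} :
    F.IsDGFreeQuotient S S' ↔ ∃ (Y : Type u) (deg : Y → ℤ) (e : Y → F.carrier),
      (∀ y, e y ∈ S' ∧ e y ∈ F.gr (deg y) ∧ F.d (e y) ∈ S) ∧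
      (∀ c : Y →₀ A.carrier, Finsupp.linearCombination A.carrier e c ∈ S → c = 0) ∧
      S' ≤ S ⊔ Submodule.span A.carrier (Set.range e) := by
  refine exists_congr fun Y => exists_congr fun deg => exists_congr fun e =>
    and_congr_right fun he => and_congr ?_ ?_
  · rw [linearIndependent_iff]
    refine forall_congr' fun c => ?_
    rw [show (fun y => S.mkQ (e y)) = S.mkQ ∘ e from rfl, ← Finsupp.apply_linearCombination,
      Submodule.mkQ_apply, Submodule.Quotient.mk_eq_zero]
  · have hspan : Submodule.span A.carrier (Set.range e) ≤ S' :=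
      Submodule.span_le.2 (by rintro _ ⟨y, rfl⟩; exact (he y).1)
    rw [show (fun y => S.mkQ (e y)) = S.mkQ ∘ e from rfl, Set.range_comp, ← Submodule.map_span,
      le_antisymm_iff, and_iff_right (Submodule.map_mono hspan), Submodule.map_le_iff_le_comap,
      Submodule.comap_map_eq, Submodule.ker_mkQ, sup_comm]

lemma isDGFreeQuotient_self (S : Submodule A.carrier F.carrier) : F.IsDGFreeQuotient S S :=
  isDGFreeQuotient_iff.2 ⟨PEmpty, PEmpty.elim, PEmpty.elim, nofun,
    fun _ _ => Subsingleton.elim _ _, le_sup_left⟩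

/-- Linear maps extend along DG free quotients, with arbitrary values on the basis. -/
lemma exists_linearMap_extension {S S' : Submodule A.carrier F.carrier} (h : S ≤ S') {Y : Type u}
    {e : Y → F.carrier} (he : ∀ y, e y ∈ S')
    (hli : ∀ c : Y →₀ A.carrier, Finsupp.linearCombination A.carrier e c ∈ S → c = 0)
    (hgen : S' ≤ S ⊔ Submodule.span A.carrier (Set.range e)) {C : Type*} [AddCommGroup C]
    [Module A.carrier C] (g : S →ₗ[A.carrier] C) (q : Y → C) :
    ∃ g' : S' →ₗ[A.carrier] C, (∀ x : S, g' ⟨x, h x.2⟩ = g x) ∧ ∀ y, g' ⟨e y, he y⟩ = q y := by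
  let e' : Y → S' := fun y => ⟨e y, he y⟩
  -- A DG free quotient splits `A`-linearly: `S'` is the sum of `S` and the free module on the `e
  -- y`.
  let ψ : (S × (Y →₀ A.carrier)) →ₗ[A.carrier] S' :=
    (Submodule.inclusion h).coprod (Finsupp.linearCombination A.carrier e')
  have hψ : ∀ x, (ψ x : F.carrier) = x.1 + Finsupp.linearCombination A.carrier e x.2 := by
    intro x
    change ((x.1 : F.carrier)) + S'.subtype (Finsupp.linearCombination A.carrier e' x.2) = _
    rw [Finsupp.apply_linearCombination]
    rfl
  have hb : Function.Bijective ψ := by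
    refine ⟨(injective_iff_map_eq_zero ψ).2 fun x hx => ?_, fun x => ?_⟩
    · have h₀ : (x.1 : F.carrier) + Finsupp.linearCombination A.carrier e x.2 = 0 := by
        rw [← hψ, hx]; rfl
      have h₁ : x.2 = 0 := hli _ (by
        rw [eq_neg_of_add_eq_zero_right h₀]
        exact neg_mem x.1.2)
      rw [h₁, map_zero, add_zero] at h₀
      exact Prod.ext (Subtype.ext h₀) h₁
    · obtain ⟨s, hs, z, hz, hsz⟩ := Submodule.mem_sup.1 (hgen x.2)
      rw [← Finsupp.range_linearCombination] at hz
      obtain ⟨c, rfl⟩ := hz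
      exact ⟨(⟨s, hs⟩, c), Subtype.ext ((hψ _).trans hsz)⟩
  let E := LinearEquiv.ofBijective ψ hb
  refine ⟨(g.coprod (Finsupp.linearCombination A.carrier q)).comp E.symm.toLinearMap,
    fun x => ?_, fun y => ?_⟩
  · have : E.symm ⟨x, h x.2⟩ = (x, 0) := (LinearEquiv.symm_apply_eq E).2
      (Subtype.ext (by rw [LinearEquiv.ofBijective_apply, hψ]; simp))
    simp [this]
  · have : E.symm ⟨e y, he y⟩ = (0, Finsupp.single y 1) := (LinearEquiv.symm_apply_eq E).2
      (Subtype.ext (by rw [LinearEquiv.ofBijective_apply, hψ]; simp))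
    simp [this]

end FreeQuotient

/-! ### The ghost lemma -/

section Ghost

/-- A morphism from a DG module with a finite semi-free filtration becomes null-homotopic after
composition with sufficiently many maps which vanish on cohomology. -/
theorem nullHomotopic_of_isGhost {fil : ℕ → Submodule A.carrier F.carrier}
    (hF : F.IsSemifreeFiltration fil) {C : ℕ → DGModule A} {κ : ∀ n, C n ⟶ C (n + 1)}
    (hκ : ∀ n, IsGhost (κ n)) {v : ∀ n, F ⟶ C n} (hv : ∀ n, v n ≫ κ n = v (n + 1)) {n : ℕ}
    (hn : fil n = ⊤) : NullHomotopic (v n) := by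
  have key : ∀ n, ∃ h : fil n →ₗ[A.carrier] (C n).carrier, ∀ x : fil n,
      (C n).d (h x) - h ⟨F.d x, (hF.isDGSubmodule n).d_mem _ x.2⟩ = lin (v n) (F.sign x) := by
    intro n
    induction n with
    | zero =>
      refine ⟨0, fun x => ?_⟩
      have hx : (x : F.carrier) = 0 := (Submodule.mem_bot A.carrier).1 (hF.zero.le x.2)
      simp [hx]
    | succ n ih =>
      obtain ⟨h, hh⟩ := ih
      obtain ⟨Y, deg, e, he, hli, hgen⟩ := isDGFreeQuotient_iff.1 (hF.free n)
      let z : Y → fil n := fun y => ⟨F.d (e y), (he y).2.2⟩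
      -- Since `d (e y)` lies in the previous step, this is the obstruction cocycle to extending the
      -- homotopy over `e y`. The ghost `κ n` makes it a boundary, whose primitive is taken as the
      -- value at `e y`.
      have hz : ∀ y, (C n).d (lin (v n) (F.sign (e y)) + h (z y)) = 0 := by
        intro y
        have h₁ := hh (z y)
        have h₂ : (⟨F.d (z y), (hF.isDGSubmodule n).d_mem _ (z y).2⟩ : fil n) = 0 :=
          Subtype.ext (F.d_d _)
        rw [h₂, map_zero, sub_zero] at h₁
        rw [map_add, h₁, ← lin_d, ← map_add, d_sign]
        simp [z]
      choose b hb using fun y => hκ n _ (hz y)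
      obtain ⟨h', hh'₁, hh'₂⟩ := exists_linearMap_extension (hF.le_succ n) (fun y => (he y).1) hli
        hgen ((lin (κ n)).comp h) b
      have hvx : ∀ x, lin (κ n) (lin (v n) x) = lin (v (n + 1)) x := fun x => by
        rw [← hv]; rfl
      -- The homotopy equation holds on a submodule, so it need only be checked on `fil n` and on
      -- the new generators.
      let T : Submodule A.carrier F.carrier :=
        { carrier := {x | ∃ hx : x ∈ fil (n + 1), (C (n + 1)).d (h' ⟨x, hx⟩) -
            h' ⟨F.d x, (hF.isDGSubmodule _).d_mem _ hx⟩ = lin (v (n + 1)) (F.sign x)}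
          zero_mem' := ⟨zero_mem _, by
            have e₁ : (⟨0, zero_mem _⟩ : fil (n + 1)) = 0 := rfl
            have e₂ : (⟨F.d 0, (hF.isDGSubmodule _).d_mem _ (zero_mem _)⟩ : fil (n + 1)) = 0 :=
              Subtype.ext (map_zero _)
            rw [e₁, e₂]; simp⟩
          add_mem' := by
            rintro x y ⟨hx, hx'⟩ ⟨hy, hy'⟩
            refine ⟨add_mem hx hy, ?_⟩
            have e₁ : (⟨x + y, add_mem hx hy⟩ : fil (n + 1)) = ⟨x, hx⟩ + ⟨y, hy⟩ := rfl
            have e₂ : (⟨F.d (x + y), (hF.isDGSubmodule _).d_mem _ (add_mem hx hy)⟩ :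
                fil (n + 1)) = ⟨F.d x, (hF.isDGSubmodule _).d_mem _ hx⟩ +
                  ⟨F.d y, (hF.isDGSubmodule _).d_mem _ hy⟩ := Subtype.ext (map_add _ _ _)
            rw [e₁, e₂]
            simp only [map_add, ← hx', ← hy']
            abel
          smul_mem' := by
            rintro a x ⟨hx, hx'⟩
            refine ⟨Submodule.smul_mem _ _ hx, ?_⟩
            have e₁ : (⟨a • x, Submodule.smul_mem _ _ hx⟩ : fil (n + 1)) = a • ⟨x, hx⟩ := rfl
            have e₂ : (⟨F.d (a • x), (hF.isDGSubmodule _).d_mem _ (Submodule.smul_mem _ _ hx)⟩ :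
                fil (n + 1)) = A.d a • ⟨x, hx⟩ +
                  (self A).sign a • ⟨F.d x, (hF.isDGSubmodule _).d_mem _ hx⟩ :=
              Subtype.ext (d_smul _ _)
            rw [e₁, e₂]
            simp only [map_add, map_smul, sign_smul, d_smul, ← hx', smul_sub]
            abel }
      have hT : fil (n + 1) ≤ T := by
        refine hgen.trans (sup_le (fun x hx => ⟨hF.le_succ n hx, ?_⟩) (Submodule.span_le.2 ?_))
        · have e₁ := hh'₁ ⟨x, hx⟩
          have e₂ := hh'₁ ⟨F.d x, (hF.isDGSubmodule n).d_mem _ hx⟩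
          rw [e₁, e₂, LinearMap.comp_apply, LinearMap.comp_apply, ← lin_d, ← map_sub, hh ⟨x, hx⟩,
            hvx]
        · rintro _ ⟨y, rfl⟩
          refine ⟨(he y).1, ?_⟩
          have e₂ := hh'₁ (z y)
          rw [hh'₂, e₂, hb, map_add, LinearMap.comp_apply, add_sub_cancel_right, hvx]
      exact ⟨h', fun x => (hT x.2).2⟩
  obtain ⟨h, hh⟩ := key n
  have hmem : ∀ x, x ∈ fil n := fun x => hn ▸ Submodule.mem_top
  exact ⟨h.comp (LinearMap.id.codRestrict _ hmem), fun x => hh ⟨x, hmem x⟩⟩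

end Ghost

/-! ### Finite semi-free filtrations: constructions and strictness -/

section Filtrations

variable (F) in
/-- `F` has a semi-free filtration with `F(n - 1) = F`. -/
def HasSemifreeLength (n : ℕ) : Prop := ∃ fil, F.IsSemifreeFiltration fil ∧ fil n = ⊤

lemma IsSemifreeFiltration.monotone {fil : ℕ → Submodule A.carrier F.carrier}
    (h : F.IsSemifreeFiltration fil) : Monotone fil := monotone_nat_of_le_succ h.le_succ

lemma isDGSubmodule_bot : F.IsDGSubmodule ⊥ :=
  ⟨fun m hm i => by
    rw [Submodule.mem_bot] at *
    rw [hm]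
    exact map_zero (F.component i), fun m hm => by
    rw [Submodule.mem_bot] at *
    rw [hm, map_zero]⟩

lemma isDGSubmodule_top : F.IsDGSubmodule ⊤ := ⟨fun _ _ _ => trivial, fun _ _ => trivial⟩

lemma hasSemifreeLength_shift_self (n : ℤ) : (shift n (self A)).HasSemifreeLength 1 := by
  refine ⟨fun i => if i = 0 then ⊥ else ⊤, ⟨if_pos rfl, fun i => ?_, fun i => ?_, fun i => ?_,
    fun x => ⟨1, trivial⟩⟩, rfl⟩
  · rw [if_neg (Nat.succ_ne_zero i)]; exact le_top
  · dsimp only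
    split_ifs
    exacts [isDGSubmodule_bot, isDGSubmodule_top]
  · dsimp only
    rw [if_neg (Nat.succ_ne_zero i)]
    split_ifs
    · refine isDGFreeQuotient_iff.2 ⟨PUnit, fun _ => -n, fun _ => (1 : A.carrier),
        fun _ => ⟨trivial, ?_, A.d_one⟩, fun c hc => ?_, fun x _ => ?_⟩
      · change (1 : A.carrier) ∈ A.gr (-n + n)
        rw [neg_add_cancel]
        exact SetLike.GradedOne.one_mem
      · refine Finsupp.ext fun ⟨⟩ => ?_
        rw [Submodule.mem_bot, Finsupp.linearCombination_unique] at hc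
        simpa using hc
      · refine Submodule.mem_sup_right ?_
        have : x = x • (1 : A.carrier) := (mul_one x).symm
        rw [this]
        exact Submodule.smul_mem _ _ (Submodule.subset_span ⟨⟨⟩, rfl⟩)
    · exact isDGFreeQuotient_self _

/-- Filtering summand by summand works for infinitely many summands because the bound `n` is common
to all of them. -/
lemma hasSemifreeLength_coprod {J : Type u} {N : J → DGModule A} {n : ℕ}
    (hN : ∀ j, (N j).HasSemifreeLength n) : (coprod N).HasSemifreeLength n := by
  classical
  choose fil hfil hn using hN
  let S : ℕ → Submodule A.carrier (coprod N).carrier :=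
    fun i => ⨅ j, (fil j i).comap (lin (coprodπ N j))
  have hS : ∀ i x, x ∈ S i ↔ ∀ j, lin (coprodπ N j) x ∈ fil j i := fun i x => by
    simp only [S, Submodule.mem_iInf, Submodule.mem_comap]
  have hι : ∀ i j x, x ∈ fil j i → lin (coprodι N j) x ∈ S i := fun i j x hx => by
    rw [hS]
    intro l
    by_cases h : j = l
    · subst h; rwa [coprodπ_ι]
    · rw [coprodπ_ι_ne h]; exact zero_mem _
  have hle : ∀ i, S i ≤ S (i + 1) := fun i x hx => by
    rw [hS] at *
    exact fun j => (hfil j).le_succ i (hx j)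
  have htop : S n = ⊤ := by
    simp only [S, hn, Submodule.comap_top, iInf_top]
  refine ⟨S, ⟨?_, hle, fun i => ⟨fun x hx l => ?_, fun x hx => ?_⟩, fun i => ?_,
    fun x => ⟨n, htop ▸ trivial⟩⟩, htop⟩
  · refine eq_bot_iff.2 fun x hx => (Submodule.mem_bot _).2 (coprod_ext fun j => ?_)
    have := (hS 0 x).1 hx j
    rw [(hfil j).zero, Submodule.mem_bot] at this
    rw [this, map_zero]
  · rw [hS] at *
    intro j
    have := ((hfil j).isDGSubmodule i).component_mem _ (hx j) l
    have e := component_lin (coprodπ N j) l x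
    exact e ▸ this
  · rw [hS] at *
    intro j
    rw [lin_d]
    exact ((hfil j).isDGSubmodule i).d_mem _ (hx j)
  · choose Y deg e he hli hgen using
      fun j => isDGFreeQuotient_iff.1 ((hfil j).free i)
    refine isDGFreeQuotient_iff.2 ⟨Σ j, Y j, fun y => deg y.1 y.2,
      fun y => lin (coprodι N y.1) (e y.1 y.2), fun y => ⟨hι _ _ _ (he _ _).1,
        lin_mem _ (he _ _).2.1, ?_⟩, fun c hc => ?_, fun x hx => ?_⟩
    · rw [← lin_d]
      exact hι _ _ _ (he _ _).2.2
    · have key : ∀ j, (lin (coprodπ N j)).comp (Finsupp.linearCombination A.carrier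
          fun y : Σ j, Y j => lin (coprodι N y.1) (e y.1 y.2)) =
          (Finsupp.linearCombination A.carrier (e j)).comp
            (Finsupp.lcomapDomain (Sigma.mk j) sigma_mk_injective) := by
        intro j
        refine Finsupp.lhom_ext fun y a => ?_
        obtain ⟨l, y⟩ := y
        rw [LinearMap.comp_apply, LinearMap.comp_apply, Finsupp.linearCombination_single, map_smul]
        by_cases h : l = j
        · subst h
          have : Finsupp.lcomapDomain (Sigma.mk l) sigma_mk_injective (R := A.carrier)
              (Finsupp.single (⟨l, y⟩ : Σ j, Y j) a) = Finsupp.single y a :=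
            Finsupp.comapDomain_single _ _ _ _
          rw [this, Finsupp.linearCombination_single, coprodπ_ι]
        · have : Finsupp.lcomapDomain (Sigma.mk j) sigma_mk_injective (R := A.carrier)
              (Finsupp.single (⟨l, y⟩ : Σ j, Y j) a) = 0 :=
            Finsupp.ext fun y' => Finsupp.single_eq_of_ne (by rintro ⟨⟩; exact h rfl)
          rw [this, map_zero, coprodπ_ι_ne h, smul_zero]
      refine Finsupp.ext fun ⟨j, y⟩ => ?_
      have h₁ := (hS i _).1 hc j
      rw [← LinearMap.comp_apply, key] at h₁
      exact DFunLike.congr_fun (hli j _ h₁) y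
    · obtain ⟨s, hs⟩ := eq_sum_coprodι x
      rw [hs]
      refine sum_mem fun j _ => ?_
      have h₁ : lin (coprodι N j) (lin (coprodπ N j) x) ∈
          (fil j i ⊔ Submodule.span A.carrier (Set.range (e j))).map (lin (coprodι N j)) :=
        Submodule.mem_map_of_mem (hgen j ((hS _ _).1 hx j))
      rw [Submodule.map_sup, Submodule.map_span] at h₁
      refine (sup_le_sup (a := Submodule.map _ _) (b := S i) ?_ (Submodule.span_mono ?_)) h₁
      · rintro _ ⟨z, hz, rfl⟩
        exact hι _ _ _ hz
      · rintro _ ⟨_, ⟨y, rfl⟩, rfl⟩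
        exact ⟨⟨j, y⟩, rfl⟩

lemma hasSemifreeLength_free {Y : Type u} (deg : Y → ℤ) :
    (free (A := A) deg).HasSemifreeLength 1 :=
  hasSemifreeLength_coprod fun _ => hasSemifreeLength_shift_self _

lemma twist_component (φ : P ⟶ shift 1 G) (i : ℤ) (x : G.carrier × P.carrier) :
    (twist φ).component i x = (G.component i x.1, P.component i x.2) := by
  induction x using (homogeneous_induction (M := twist φ)) with
  | zero => rw [map_zero]; exact Prod.ext (map_zero _).symm (map_zero _).symm
  | hom j x hx =>
    by_cases h : j = i
    · subst h
      rw [component_of_mem hx, component_of_mem hx.1, component_of_mem hx.2]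
    · rw [component_of_mem_ne hx h, component_of_mem_ne hx.1 h, component_of_mem_ne hx.2 h]
      rfl
  | add m m' h h' => rw [map_add, h, h']; exact Prod.ext (map_add _ _ _).symm (map_add _ _ _).symm

/-- The submodule `G` is filtered first and the filtration of `P` is stacked on top, so lengths add.
-/
lemma hasSemifreeLength_twist (φ : P ⟶ shift 1 G) {m n : ℕ} (hG : G.HasSemifreeLength n)
    (hP : P.HasSemifreeLength m) : (twist φ).HasSemifreeLength (n + m) := by
  obtain ⟨fG, hfG, hn⟩ := hG
  obtain ⟨fP, hfP, hm⟩ := hP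
  have hGtop : ∀ i, n ≤ i → fG i = ⊤ := fun i hi => eq_top_iff.2 (hn ▸ hfG.monotone hi)
  -- Truncated subtraction keeps the second factor at `fP 0 = ⊥` as long as `i ≤ n`, while the first
  -- factor is everything from `i = n` on.
  let S : ℕ → Submodule A.carrier (twist φ).carrier := fun i => (fG i).prod (fP (i - n))
  have hle : ∀ i, S i ≤ S (i + 1) := fun i =>
    Submodule.prod_mono (hfG.le_succ i) (hfP.monotone (by omega))
  have htop : S (n + m) = ⊤ := by
    simp only [S, hGtop _ (Nat.le_add_right n m), Nat.add_sub_cancel_left, hm, Submodule.prod_top]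
  refine ⟨S, ⟨?_, hle, fun i => ⟨fun x hx l => ?_, fun x hx => ?_⟩, fun i => ?_,
    fun x => ⟨n + m, htop ▸ trivial⟩⟩, htop⟩
  · simp only [S, Nat.zero_sub, hfG.zero, hfP.zero, Submodule.prod_bot]
  · have e := twist_component φ l x
    have h₁ := (hfG.isDGSubmodule i).component_mem _ hx.1 l
    have h₂ := (hfP.isDGSubmodule (i - n)).component_mem _ hx.2 l
    change (twist φ).component l x ∈ S i
    rw [e]
    exact ⟨h₁, h₂⟩
  · obtain ⟨g, p⟩ := x
    rw [twist_d]
    refine ⟨add_mem ((hfG.isDGSubmodule i).d_mem _ hx.1) ?_, (hfP.isDGSubmodule _).d_mem _ hx.2⟩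
    -- The twisting term of the differential lands in `G`. It is harmless once all of `G` is
    -- present, and it vanishes before that since the `P`-part is zero.
    by_cases h : n ≤ i
    · rw [hGtop i h]; trivial
    · have hp : p ∈ fP (i - n) := hx.2
      rw [Nat.sub_eq_zero_of_le (not_le.1 h).le, hfP.zero, Submodule.mem_bot] at hp
      rw [hp, map_zero, map_zero]
      exact zero_mem _
  · by_cases h : n ≤ i
    · obtain ⟨Y, deg, e, he, hli, hgen⟩ := isDGFreeQuotient_iff.1 (hfP.free (i - n))
      have hs : i + 1 - n = i - n + 1 := by omega
      have hSi : ∀ x, x ∈ S i ↔ x.2 ∈ fP (i - n) := fun x => by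
        simp [S, hGtop i h]
      have hSi' : ∀ x, x ∈ S (i + 1) ↔ x.2 ∈ fP (i - n + 1) := fun x => by
        simp [S, hGtop (i + 1) (by omega), hs]
      refine isDGFreeQuotient_iff.2 ⟨Y, deg, fun y => (0, e y),
        fun y => ⟨(hSi' _).2 (he y).1, ⟨zero_mem _, (he y).2.1⟩, (hSi _).2 (he y).2.2⟩,
        fun c hc => hli c ?_, fun x hx => ?_⟩
      · have := (hSi _).1 hc
        rwa [← LinearMap.snd_apply (R := A.carrier), Finsupp.apply_linearCombination] at this
      · obtain ⟨s, hs, z, hz, hsz⟩ := Submodule.mem_sup.1 (hgen ((hSi' x).1 hx))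
        refine Submodule.mem_sup.2 ⟨(x.1, s), (hSi _).2 hs, (0, z), ?_, Prod.ext (add_zero _) hsz⟩
        have := Submodule.mem_map_of_mem (f := LinearMap.inr A.carrier G.carrier P.carrier) hz
        rw [Submodule.map_span, ← Set.range_comp] at this
        exact this
    · obtain ⟨Y, deg, e, he, hli, hgen⟩ := isDGFreeQuotient_iff.1 (hfG.free i)
      have h₁ : i - n = 0 := by omega
      have h₂ : i + 1 - n = 0 := by omega
      have hSi : ∀ x, x ∈ S i ↔ x.1 ∈ fG i ∧ x.2 = 0 := fun x => by
        simp [S, h₁, hfP.zero, Submodule.mem_prod]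
      have hSi' : ∀ x, x ∈ S (i + 1) ↔ x.1 ∈ fG (i + 1) ∧ x.2 = 0 := fun x => by
        simp [S, h₂, hfP.zero, Submodule.mem_prod]
      refine isDGFreeQuotient_iff.2 ⟨Y, deg, fun y => (e y, 0),
        fun y => ⟨(hSi' _).2 ⟨(he y).1, rfl⟩, ⟨(he y).2.1, zero_mem _⟩,
          (hSi _).2 ⟨?_, map_zero _⟩⟩, fun c hc => hli c ?_, fun x hx => ?_⟩
      · change G.d (e y) + lin φ (P.sign 0) ∈ _
        rw [map_zero, map_zero]
        exact (add_zero (G.d (e y))).symm ▸ (he y).2.2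
      · have := ((hSi _).1 hc).1
        rwa [← LinearMap.fst_apply (R := A.carrier), Finsupp.apply_linearCombination] at this
      · obtain ⟨hx₁, hx₂⟩ := (hSi' x).1 hx
        obtain ⟨s, hs, z, hz, hsz⟩ := Submodule.mem_sup.1 (hgen hx₁)
        refine Submodule.mem_sup.2 ⟨(s, 0), (hSi _).2 ⟨hs, rfl⟩, (z, 0), ?_,
          Prod.ext hsz ((add_zero _).trans hx₂.symm)⟩
        have := Submodule.mem_map_of_mem (f := LinearMap.inl A.carrier G.carrier P.carrier) hz
        rw [Submodule.map_span, ← Set.range_comp] at this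
        exact this

lemma HasSemifreeLength.shift {n : ℕ} (hF : F.HasSemifreeLength n) (l : ℤ) :
    (shift l F).HasSemifreeLength n := by
  obtain ⟨fil, h, hn⟩ := hF
  refine ⟨fil, ⟨h.zero, h.le_succ, fun i => ⟨fun x hx j => ?_, (h.isDGSubmodule i).d_mem⟩,
    fun i => ?_, h.exhaustive⟩, hn⟩
  · have e : (DGModule.shift l F).component j x = F.component (j + l) x := by
      clear hx
      induction x using homogeneous_induction (M := F) with
      | zero => rw [map_zero, map_zero]
      | hom i x hx =>
        have hx' : x ∈ (DGModule.shift l F).gr (i - l) := by simpa using hx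
        by_cases h : i = j + l
        · subst h
          rw [component_of_mem hx, component_of_mem (by simpa using hx')]
        · rw [component_of_mem_ne hx h, component_of_mem_ne hx' (by omega)]
      | add x y hx hy => rw [map_add, map_add, hx, hy]
    change (DGModule.shift l F).component j x ∈ fil i
    rw [e]
    exact (h.isDGSubmodule i).component_mem x hx (j + l)
  · obtain ⟨Y, deg, e, he, hli, hgen⟩ := h.free i
    exact ⟨Y, fun y => deg y - l, e, fun y => ⟨(he y).1, by
      change e y ∈ F.gr (deg y - l + l)
      rw [sub_add_cancel]
      exact (he y).2.1, (he y).2.2⟩, hli, hgen⟩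

/-- A nonzero DG module with a finite semi-free filtration has a strictly increasing one. -/
lemma HasSemifreeLength.exists_hasStrictFiltrationOfLength [Nontrivial F.carrier] {n : ℕ}
    (hF : F.HasSemifreeLength n) : ∃ m, F.HasStrictFiltrationOfLength m := by
  classical
  have hex : ∃ n, F.HasSemifreeLength n := ⟨n, hF⟩
  obtain ⟨fil, h, htop⟩ := Nat.find_spec hex
  have hmin : ∀ m, m < Nat.find hex → ¬ F.HasSemifreeLength m := fun m => Nat.find_min hex
  generalize Nat.find hex = l at htop hmin
  -- Here `fil i` stands for `F(i - 1)`, so a least index `l + 1` with `fil (l + 1) = ⊤` gives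
  -- length `l`. The index `0` is excluded because `F` is nonzero.
  obtain _ | l := l
  · exact absurd (h.zero.symm.trans htop) bot_ne_top
  refine ⟨l, fil, h, fun i hi he => ?_, htop, fun e => hmin l (Nat.lt_succ_self l) ⟨fil, h, e⟩⟩
  have hil : i < l + 1 := by
    by_contra hil
    exact hi (eq_top_iff.2 (htop ▸ h.monotone (not_lt.1 hil)))
  have hil' : i ≠ l := fun e => hi (by rw [he, e, htop])
  -- If `fil i = fil (i + 1)`, then omitting the index `i + 1` gives a semi-free filtration that is
  -- shorter by one, against minimality.
  let s : ℕ → ℕ := fun j => if j ≤ i then j else j + 1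
  have hs : ∀ j, ∃ m, fil (s j) = fil m ∧ fil (s (j + 1)) = fil (m + 1) := fun j => by
    simp only [s]
    rcases lt_trichotomy j i with h₁ | rfl | h₁
    · exact ⟨j, by rw [if_pos h₁.le], by rw [if_pos (by omega)]⟩
    · exact ⟨j + 1, by rw [if_pos le_rfl, he], by rw [if_neg (by omega)]⟩
    · exact ⟨j + 1, by rw [if_neg (by omega)], by rw [if_neg (by omega)]⟩
  refine hmin l (Nat.lt_succ_self l) ⟨fun j => fil (s j), ⟨?_, fun j => ?_,
    fun j => h.isDGSubmodule _, fun j => ?_, fun x => ?_⟩, ?_⟩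
  · simp only [s, if_pos (Nat.zero_le i), h.zero]
  · obtain ⟨m, h₁, h₂⟩ := hs j
    exact h₁ ▸ h₂ ▸ h.le_succ m
  · obtain ⟨m, h₁, h₂⟩ := hs j
    exact h₁ ▸ h₂ ▸ h.free m
  · obtain ⟨m, hm⟩ := h.exhaustive x
    refine ⟨m, h.monotone ?_ hm⟩
    simp only [s]
    split_ifs <;> omega
  · simp only [s, if_neg (show ¬ l ≤ i by omega), htop]

end Filtrations

end DGModule

namespace DGModule
variable {k : Type v} [Field k] {A : DGAlgebra.{v, u} k} {M N P G F : DGModule A}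

/-! ### Noetherian cohomology -/

section Finiteness

instance : IsScalarTower A.cocycles A.Cohomology M.Cohomology :=
  ⟨fun z q x => by
    obtain ⟨w, rfl⟩ := Submodule.Quotient.mk_surjective _ q
    exact mul_smul z w x⟩

/-- The cocycles act on cohomology through the quotient `H(A)`, so submodules over either ring
coincide. Working over the cocycles matches the linearity of `cohomologyMap`. -/
lemma isNoetherian_cocycles [IsNoetherian A.Cohomology M.Cohomology] :
    IsNoetherian A.cocycles M.Cohomology := by
  refine ⟨fun S => ?_⟩
  let T : Submodule A.Cohomology M.Cohomology :=
    { S with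
      smul_mem' := fun q x hx => by
        obtain ⟨w, rfl⟩ := Submodule.Quotient.mk_surjective _ q
        exact S.smul_mem w hx }
  have h₁ : Module.Finite A.Cohomology T := Module.Finite.iff_fg.2 (IsNoetherian.noetherian T)
  have h₂ : Module.Finite A.cocycles T := Module.Finite.trans A.Cohomology T
  have h₃ : Module.Finite A.cocycles S := h₂
  exact Module.Finite.iff_fg.1 h₃

lemma isNoetherian_of_finite_cocycles [IsNoetherianRing A.Cohomology]
    (h : Module.Finite A.cocycles M.Cohomology) : IsNoetherian A.cocycles M.Cohomology := by
  have : Module.Finite A.Cohomology M.Cohomology :=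
    Module.Finite.of_restrictScalars_finite A.cocycles _ _
  exact isNoetherian_cocycles

lemma isNoetherian_cohomology_self [IsNoetherianRing A.Cohomology] :
    IsNoetherian A.cocycles (self A).Cohomology := by
  have h : Module.Finite A.cocycles (self A).Cohomology := by
    refine Module.Finite.of_surjective (LinearMap.toSpanSingleton A.cocycles (self A).Cohomology
      (Submodule.Quotient.mk ⟨(1 : A.carrier), A.d_one⟩)) fun x => ?_
    obtain ⟨⟨z, hz⟩, rfl⟩ := Submodule.Quotient.mk_surjective _ x
    refine ⟨⟨z, hz⟩, ?_⟩
    rw [LinearMap.toSpanSingleton_apply, ← Submodule.Quotient.mk_smul]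
    exact congrArg Submodule.Quotient.mk (Subtype.ext (mul_one z))
  exact isNoetherian_of_finite_cocycles h

/-- This rests on the exactness at the middle term of `H(G) → H(twist φ) → H(P)`: if `p = d p'`,
subtracting the boundary of `(0, p')` moves the cocycle `(g, p)` into `G`. -/
lemma isNoetherian_cohomology_twist (φ : P ⟶ shift 1 G) (hG : IsNoetherian A.cocycles G.Cohomology)
    (hP : IsNoetherian A.cocycles P.Cohomology) :
    IsNoetherian A.cocycles (twist φ).Cohomology := by
  refine isNoetherian_of_range_eq_ker (cohomologyMap (twistInl φ)) (cohomologyMap (twistSnd φ))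
    (le_antisymm ?_ fun x hx => ?_)
  · rintro _ ⟨x, rfl⟩
    rw [LinearMap.mem_ker, ← cohomologyMap_comp, ← cohomologyMap_zero x]
    rfl
  · obtain ⟨⟨⟨g, p⟩, hgp⟩, rfl⟩ := Submodule.Quotient.mk_surjective _ x
    obtain ⟨p', hp'⟩ := (mk_eq_zero_iff _).1 hx
    replace hp' : P.d p' = p := hp'
    have e : (twist φ).d (0, p') = (lin φ (P.sign p'), p) := by
      rw [twist_d, map_zero, hp', zero_add]
    have hd : G.d (g - lin φ (P.sign p')) = 0 := by
      have h₁ : (twist φ).d ((g, p) - (twist φ).d (0, p')) = 0 := by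
        rw [map_sub, (twist φ).d_d, sub_zero]
        exact hgp
      rw [e, Prod.mk_sub_mk, sub_self, twist_d, map_zero, map_zero] at h₁
      exact (add_zero _).symm.trans (congrArg Prod.fst h₁)
    refine ⟨Submodule.Quotient.mk ⟨_, hd⟩, ?_⟩
    have : ∃ y, (twist φ).d y = (g, p) - (g - lin φ (P.sign p'), 0) := ⟨(0, p'), by
      rw [e]
      exact Prod.ext (sub_sub_cancel g _).symm (sub_zero p).symm⟩
    exact ((Submodule.Quotient.eq _).2 this).symm

lemma isNoetherian_cohomology_coprod {J : Type u} [Finite J] {N : J → DGModule A}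
    (hN : ∀ j, IsNoetherian A.cocycles (N j).Cohomology) :
    IsNoetherian A.cocycles (coprod N).Cohomology := by
  refine isNoetherian_of_injective (LinearMap.pi fun j => cohomologyMap (coprodπ N j))
    ((injective_iff_map_eq_zero _).2 fun x hx => ?_)
  obtain ⟨⟨x, hd⟩, rfl⟩ := Submodule.Quotient.mk_surjective _ x
  choose z hz using fun j => (mk_eq_zero_iff _).1 (congrFun hx j)
  obtain ⟨s, hs⟩ := eq_sum_coprodι x
  refine (mk_eq_zero_iff _).2 ⟨∑ j ∈ s, lin (coprodι N j) (z j), ?_⟩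
  rw [map_sum]
  refine Eq.trans (Finset.sum_congr rfl fun j _ => ?_) hs.symm
  rw [← lin_d, hz]
  rfl

lemma isNoetherian_cohomology_free [IsNoetherianRing A.Cohomology] {Y : Type u} [Finite Y]
    (deg : Y → ℤ) : IsNoetherian A.cocycles (free (A := A) deg).Cohomology :=
  isNoetherian_cohomology_coprod fun _ => isNoetherian_cohomology_self (A := A)

lemma isNoetherian_cohomology_cone {f : G ⟶ M} (hG : IsNoetherian A.cocycles G.Cohomology)
    (hM : IsNoetherian A.cocycles M.Cohomology) : IsNoetherian A.cocycles (cone f).Cohomology :=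
  isNoetherian_cohomology_twist _ hM hG

/-- The finite generating set is extracted from the homogeneous classes, so that it defines a
morphism from a DG free module. -/
lemma exists_finite_span_cls (h : IsNoetherian A.cocycles M.Cohomology) :
    ∃ (Y : Type u) (_ : Finite Y) (c : Y → HomogeneousCocycle M),
      Submodule.span A.cocycles (Set.range fun y => (c y).cls) = ⊤ := by
  obtain ⟨s, hs, hspan⟩ := (Submodule.fg_span_iff_fg_span_finset_subset _).1
    (IsNoetherian.noetherian
      (Submodule.span A.cocycles (Set.range (HomogeneousCocycle.cls (M := M)))))
  choose c hc using fun y : s => hs y.2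
  refine ⟨s, inferInstance, c, ?_⟩
  rw [← span_range_cls, hspan]
  congr 1
  ext x
  simp [hc]

end Finiteness

/-! ### The two implications -/

section Main

lemma exists_retract_of_nullHomotopic {u : P ⟶ M} (hu : IsQuasiIso u) {f : G ⟶ M}
    (h : NullHomotopic (u ≫ coneInl f)) :
    ∃ i : (toDerivedCat A).obj M ⟶ (toDerivedCat A).obj G,
      i ≫ (toDerivedCat A).map f = 𝟙 _ := by
  obtain ⟨g, hg⟩ := exists_factor_of_nullHomotopic u f h
  have := isIso_map hu
  refine ⟨inv ((toDerivedCat A).map u) ≫ (toDerivedCat A).map g, ?_⟩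
  rw [Category.assoc, ← Functor.map_comp, ← hg.map_eq, IsIso.inv_hom_id]

/-- The tower is built with finitely many cells at each stage. The ghost lemma, applied to `F ⟶ M`
followed by the inclusions into the cones, makes `M` a retract of a stage that is K-projective and
finitely generated. -/
theorem isCompact_of_hasSemifreeLength [IsNoetherianRing A.Cohomology]
    (hM : M.IsCohomologicallyFinite) {u : F ⟶ M} (hu : IsQuasiIso u) {n : ℕ}
    (hF : F.HasSemifreeLength n) : M.IsCompact := by
  have : Module.Finite A.Cohomology M.Cohomology := hM
  have hMN : IsNoetherian A.cocycles M.Cohomology := isNoetherian_cocycles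
  obtain ⟨G, f, ι, h, hg, hR⟩ := exists_tower (M := M)
    (fun G _ => G.IsKProjective ∧ Module.Finite A.carrier G.carrier ∧
      IsNoetherian A.cocycles G.Cohomology)
    (0 : self A ⟶ M)
    ⟨isKProjective_self A, Module.Finite.self A.carrier, isNoetherian_cohomology_self⟩
    fun G f ⟨hG₁, hG₂, hG₃⟩ => by
      obtain ⟨Y, _, c, hc⟩ := exists_finite_span_cls (isNoetherian_cohomology_cone (f := f) hG₃ hMN)
      refine ⟨_, freeDesc c, cohomologySurjective_freeDesc c hc, fun _ =>
        ⟨isKProjective_twist _ hG₁ (isKProjective_free _), ?_,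
          isNoetherian_cohomology_twist _ hG₃ (isNoetherian_cohomology_free _)⟩⟩
      have : Module.Finite A.carrier (Π₀ _ : Y, A.carrier) := inferInstance
      have : Module.Finite A.carrier (free (A := A) fun y => (c y).1).carrier := this
      exact Module.Finite.prod
  obtain ⟨fil, hfil, htop⟩ := hF
  have hnull := nullHomotopic_of_isGhost hfil hg (v := fun n => u ≫ coneInl (f n))
    (fun n => by rw [Category.assoc, coneInl_coneMap]) htop
  obtain ⟨i, hi⟩ := exists_retract_of_nullHomotopic hu hnull
  obtain ⟨h₁, h₂, -⟩ := hR n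
  exact isCompact_of_retract (fun J N φ => finitelySupported_of_finite h₁ N φ) i _ hi

/-- A morphism from a compact object to the stages of a sequence with transition maps vanishing on
cohomology vanishes eventually. -/
lemma IsCompact.exists_map_eq_zero (hM : M.IsCompact) {C : ℕ → DGModule A}
    {κ : ∀ n, C n ⟶ C (n + 1)} (hκ : ∀ n, IsGhost (κ n)) {v : ∀ n, M ⟶ C n}
    (hv : ∀ n, v n ≫ κ n = v (n + 1)) : ∃ n, (toDerivedCat A).map (v n) = 0 := by
  have := isIso_map (isQuasiIso_idSubShift κ hκ)
  -- Inverting `id - shift` on the element `v 0` at stage `0` acts like a geometric series: the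
  -- successive components are `v 0`, `v 0 ≫ κ 0 = v 1`, and so on.
  let ψ := (toDerivedCat A).map (v 0 ≫ seqι C 0) ≫ inv ((toDerivedCat A).map (idSubShift κ))
  have hψ : ψ ≫ (toDerivedCat A).map (idSubShift κ) = (toDerivedCat A).map (v 0 ≫ seqι C 0) := by
    simp [ψ]
  have key : ∀ n, ψ ≫ (toDerivedCat A).map (seqπ C n) = (toDerivedCat A).map (v n) := by
    intro n
    induction n with
    | zero =>
      rw [← idSubShift_π_zero κ, Functor.map_comp, ← Category.assoc, hψ, ← Functor.map_comp,
        Category.assoc, seqι_π, Category.comp_id]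
    | succ n ih =>
      have h₁ : seqπ C (n + 1) = idSubShift κ ≫ seqπ C (n + 1) + seqπ C n ≫ κ n := by
        rw [idSubShift_π_succ, sub_add_cancel]
      rw [h₁, Functor.map_add, Preadditive.comp_add, Functor.map_comp, ← Category.assoc, hψ,
        ← Functor.map_comp, Category.assoc, seqι_π_ne (by omega), comp_zero, Functor.map_zero,
        zero_add, Functor.map_comp, ← Category.assoc, ih, ← Functor.map_comp, hv]
  have hfin := finite_of_mem_finitelySupported (hM.mem_finitelySupported _ ψ)
  obtain ⟨⟨n⟩, hn⟩ := hfin.exists_notMem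
  refine ⟨n, ?_⟩
  rw [← key]
  exact not_not.1 hn

/-- A homotopy retract of a K-projective DG module `G` is quasi-isomorphic to the mapping telescope
of an endomorphism of `G`. -/
lemma exists_quasiIso_telescope_of_retract {u : P ⟶ M} (hu : IsQuasiIso u) (hG : G.IsKProjective)
    (f : G ⟶ M) (i : P ⟶ G) (hi : NullHomotopic (u - i ≫ f)) :
    ∃ (t : ℕ → (G ⟶ G)) (w : cone (idSubShift (G := fun _ => G) t) ⟶ M), IsQuasiIso w := by
  -- Up to homotopy `i` is a section of `f` and `p` is `f` lifted through `u`, so `p ≫ i` represents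
  -- the idempotent of `G` that cuts out `M`.
  obtain ⟨p, hp⟩ := hG.exists_lift hu f
  obtain ⟨hu₁, hu₂⟩ := (isQuasiIso_iff u).1 hu
  refine ⟨fun _ => p ≫ i, exists_quasiIso_telescope (G := fun _ => G) _ (fun _ => f) (fun _ => ?_)
    (fun m hm => ?_) (fun _ g hg hm => ?_)⟩
  · have := hp.add (hi.precomp p)
    rwa [Preadditive.comp_sub, sub_add_sub_cancel, ← Category.assoc] at this
  · obtain ⟨x, hx, m', hm'⟩ := hu₂ m hm
    obtain ⟨b, hb⟩ := hi.isGhost x hx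
    refine ⟨0, lin i x, by rw [← lin_d, hx, map_zero], m' + b, ?_⟩
    rw [map_add, hm', hb, lin_sub, LinearMap.sub_apply, lin_comp, LinearMap.comp_apply]
    abel
  · obtain ⟨m, hm⟩ := hm
    obtain ⟨b, hb⟩ := hp.isGhost g hg
    rw [lin_sub, LinearMap.sub_apply, lin_comp, LinearMap.comp_apply] at hb
    -- A class killed by `f` is killed by `p`, since `u` is injective on cohomology; hence it is
    -- killed by the transition map `p ≫ i`.
    obtain ⟨x, hx⟩ := hu₁ (lin p g) (by rw [← lin_d, hg, map_zero])
      ⟨m - b, by rw [map_sub, hm, hb, sub_sub_cancel]⟩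
    exact ⟨lin i x, by rw [← lin_d, hx]; rfl⟩

theorem IsCompact.exists_hasSemifreeLength [Nontrivial A.carrier] (hM : M.IsCompact) :
    ∃ (F : DGModule A) (w : F ⟶ M) (n : ℕ), IsQuasiIso w ∧ Nontrivial F.carrier ∧
      F.HasSemifreeLength n := by
  obtain ⟨G, f, ι, h, hg, hR⟩ := exists_tower (M := M)
    (fun G _ => G.IsKProjective ∧ Nontrivial G.carrier ∧ ∃ n, G.HasSemifreeLength n)
    -- The tower starts at `A` rather than at `0` so that every stage is nonzero: the zero module
    -- has no strict filtration of a length `n ∈ ℕ`, as this requires `fil n ≠ ⊤`.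
    (0 : shift 0 (self A) ⟶ M)
    ⟨(isKProjective_self A).shift 0, ‹_›, 1, hasSemifreeLength_shift_self 0⟩
    fun G f ⟨hG₁, hG₂, n, hG₃⟩ => ⟨_, freeDesc (fun y : HomogeneousCocycle (cone f) => y),
        cohomologySurjective_freeDesc _ (span_range_cls _),
        fun _ => ⟨isKProjective_twist _ hG₁ (isKProjective_free _),
          (Prod.fst_surjective (α := G.carrier)).nontrivial, _,
          hasSemifreeLength_twist _ hG₃ (hasSemifreeLength_free _)⟩⟩
  obtain ⟨n, hn⟩ := hM.exists_map_eq_zero hg (v := fun n => coneInl (f n))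
    fun n => coneInl_coneMap _
  obtain ⟨P, u, hP, hu⟩ := exists_kProjective_resolution M
  have hnull : NullHomotopic (u ≫ coneInl (f n)) := hP.nullHomotopic_of_map_eq_zero (by
    rw [Functor.map_comp, hn, comp_zero])
  obtain ⟨i, hi⟩ := exists_factor_of_nullHomotopic u (f n) hnull
  obtain ⟨hG₁, hG₂, l, hG₃⟩ := hR n
  obtain ⟨t, w, hw⟩ := exists_quasiIso_telescope_of_retract hu hG₁ (f n) i hi
  have hS : (seqSum fun _ : ℕ => G n).HasSemifreeLength l := hasSemifreeLength_coprod fun _ => hG₃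
  -- The telescope is an extension of one countable sum of copies of `G n` by a shift of another, so
  -- `l + l` steps suffice.
  refine ⟨_, w, _, hw, ?_, hasSemifreeLength_twist _ hS (hS.shift 1)⟩
  have hinj : Function.Injective (lin (seqι (fun _ => G n) 0)) := fun x y hxy => by
    have := congrArg (lin (seqπ (fun _ => G n) 0)) hxy
    rwa [← LinearMap.comp_apply, ← LinearMap.comp_apply, ← lin_comp, seqι_π] at this
  have := hinj.nontrivial
  exact (Prod.fst_surjective (α := (seqSum fun _ : ℕ => G n).carrier)).nontrivial

lemma HasStrictFiltrationOfLength.hasSemifreeLength {n : ℕ}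
    (h : F.HasStrictFiltrationOfLength n) : F.HasSemifreeLength (n + 1) := by
  obtain ⟨fil, h₁, -, h₂, -⟩ := h
  exact ⟨fil, h₁, h₂⟩

/-- An infimum in `ℕ∞` is finite exactly when some term is, and a strict filtration already
witnesses semi-freeness. -/
lemma coneLength_lt_top_iff : M.coneLength < ⊤ ↔ ∃ (F : DGModule A) (u : F ⟶ M) (n : ℕ),
    IsQuasiIso u ∧ F.HasStrictFiltrationOfLength n := by
  simp only [coneLength, dgFreeClass, iInf_lt_iff]
  constructor
  · rintro ⟨F, -, u, hu, n, hn, -⟩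
    exact ⟨F, u, n, hu, hn⟩
  · rintro ⟨F, u, n, hu, hn⟩
    obtain ⟨fil, hfil, -⟩ := id hn
    exact ⟨F, ⟨fil, hfil⟩, u, hu, n, hn, ENat.natCast_lt_top n⟩

end Main

end DGModule

end

theorem mainTheorem9 {k : Type v} [Field k] (A : DGAlgebra.{v, u} k) (hA : A.IsConnected)
    (hN : IsNoetherianRing A.Cohomology) (M : DGModule A) (hM : M.IsCohomologicallyFinite) :
    M.IsCompact ↔ M.coneLength < ⊤ := by
  rw [DGModule.coneLength_lt_top_iff]
  constructor
  · intro h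
    -- Connectedness enters through `k → A` being injective, which makes `A` nonzero and lets the
    -- tower start at a nonzero module.
    have : Nontrivial A.carrier := hA.injective.nontrivial
    obtain ⟨F, w, n, hw, hF, hn⟩ := h.exists_hasSemifreeLength
    obtain ⟨m, hm⟩ := hn.exists_hasStrictFiltrationOfLength
    exact ⟨F, w, m, hw, hm⟩
  · rintro ⟨F, u, n, hu, hn⟩
    exact DGModule.isCompact_of_hasSemifreeLength hM hu hn.hasSemifreeLength
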